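/- **Setting.** Let $M=(\mathcal S,\mathcal A,P,R,\gamma,s_0)$ be a discounted MDP with finite state and action spaces, rewards $R:\mathcal S\times\mathcal A\to[0,R_{\max}]$, $\gamma\in[0,1)$ and deterministic initial state $s_0$; put $V_{\max}=R_{\max}/(1-\gamma)$. For a policy $\pi:\mathcal S\to\Delta(\mathcal A)$ write $f(s,\pi)=\mathbb E_{a\sim\pi(\cdot|s)}f(s,a)$, $(\mathcal T^\pi f)(s,a)=R(s,a)+\gamma\,\mathbb E_{s'\sim P(\cdot|s,a)}f(s',\pi)$, $J(\pi)=\mathbb E[\sum_{t\ge0}\gamma^tR(s_t,a_t)\mid\pi]$ and $d_\pi(s,a)=(1-\gamma)\,\mathbb E[\sum_{t\ge0}\gamma^t\mathbf 1[s_t=s,a_t=a]\mid\pi]$. For a distribution $\nu$ on $\mathcal S\times\mathcal A$ let $\|f\|_{2,\nu}^2=\mathbb E_\nu[f^2]$. The dataset $\mathcal D$ consists of $n\ge1$ i.i.d. tuples $(s,a,r,s')$ with $(s,a)\sim\mu$, $r=R(s,a)$, $s'\sim P(\cdot|s,a)$. Let $\mathcal F$ be a finite non-empty set of functions $\mathcal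 S\times\mathcal A\to[0,V_{\max}]$, and let $$\mathcal L(f',f,\pi;\mathcal D)=\frac1n\sum_{(s,a,r,s')\in\mathcal D}\big(f'(s,a)-r-\gamma f(s',\pi)\big)^2,\qquad \mathcal E(f,\pi;\mathcal D)=\mathcal L(f,f,\pi;\mathcal D)-\min_{f'\in\mathcal F}\mathcal L(f',f,\pi;\mathcal D),$$ $$\mathscr C(\nu;\mu,\mathcal F,\pi)=\max_{f\in\mathcal F}\frac{\|f-\mathcal T^\pi f\|_{2,\nu}^2}{\|f-\mathcal T^\pi f\|_{2,\mu}^2}\in[0,\infty]\quad(0/0=0,\ c/0=\infty\text{ for }c>0).$$ **Algorithm (PSPI)** with parameters $\lambda,\eta$ and $T\ge1$ rounds: $\pi_1$ is the uniform policy; for $t=1,\dots,T$, $f_t\in\arg\min_{f\in\mathcal F}\big(f(s_0,\pi_t)+\lambda\,\mathcal E(f,\pi_t;\mathcal D)\big)$ (ties broken arbitrarily) and $\pi_{t+1}(a|s)\propto\pi_t(a|s)\exp(\eta f_t(s,a))$. The output $\bar\pi$ is the uniform mixture of $\pi_1,\dots,\pi_T$ at the trajectory level. Let $\Pi_{\rm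 SPI}$ be the set of policies $\pi'(\cdot|s)\propto\exp\big(\eta\sum_{i=1}^tg_i(s,\cdot)\big)$ with $1\le t\le T$ and $g_1,\dots,g_t\in\mathcal F$. **Theorem.** There is a universal constant $C>0$ such that the following holds in every such setting. Let $\delta\in(0,1)$ and $$\eta=\sqrt{\frac{\log|\mathcal A|}{2V_{\max}^2T}},\qquad \varepsilon_r=\frac{139\,V_{\max}^2\log\frac{|\mathcal F||\Pi_{\rm SPI}|}{\delta}}{n}+39\,\varepsilon_{\mathcal F},\qquad \lambda=\Big(\frac{V_{\max}}{(1-\gamma)^2\varepsilon_r^2}\Big)^{1/3}.$$ Let $\pi$ be any policy, put $\Pi=\Pi_{\rm SPI}\cup\{\pi\}$, and suppose that for every $\pi'\in\Pi$ $$\inf_{f\in\mathcal F}\ \sup_{\nu\in\{\mu\}\cup\{d_{\pi''}:\pi''\in\Pi\}}\|f-\mathcal T^{\pi'}f\|_{2,\nu}^2\le\varepsilon_{\mathcal F}\qquad\text{and}\qquad \sup_{f\in\mathcal F}\inf_{f'\in\mathcal F}\|f'-\mathcal T^{\pi'}f\|_{2,\mu}^2\le\varepsilon_{\mathcal F,\mathcal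 F}.$$ Then, for any constant $C_2\ge1$, with probability at least $1-\delta$, $$J(\pi)-J(\bar\pi)\le C\sqrt{C_2}\left(\frac{\sqrt{\varepsilon_{\mathcal F,\mathcal F}+\varepsilon_{\mathcal F}}}{1-\gamma}+\frac{V_{\max}}{1-\gamma}\sqrt[3]{\frac{T\log\frac{|\mathcal F|}{\delta}}{n}}+\sqrt[3]{\frac{V_{\max}\varepsilon_{\mathcal F}}{(1-\gamma)^2}}\right)+C\,\frac{V_{\max}}{1-\gamma}\sqrt{\frac{\log|\mathcal A|}{T}}$$ $$\qquad+\frac1T\sum_{t=1}^T\ \min_{\nu:\ \mathscr C(\nu;\mu,\mathcal F,\pi_t)\le C_2}\left|\sum_{(s,a)}\frac{(d_\pi\setminus\nu)(s,a)\,\big[f_t(s,a)-(\mathcal T^{\pi_t}f_t)(s,a)\big]}{1-\gamma}\right|,$$ where $\nu$ ranges over the distributions on $\mathcal S\times\mathcal A$ and $(d_\pi\setminus\nu)(s,a)=\max(d_\pi(s,a)-\nu(s,a),0)$. -/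

import Mathlib

open MeasureTheory ProbabilityTheory
open scoped BigOperators ENNReal

noncomputable section

namespace OfflineRL

/-- A stochastic policy: a map from states to the probability simplex over actions. -/
abbrev Policy (S A : Type*) [Fintype A] := S → stdSimplex ℝ A

/-- A discounted Markov decision process with finite state space `S` and finite action space `A`,
rewards in `[0, Rmax]` and a deterministic initial state. -/
structure MDP (S A : Type*) [Fintype S] where
  /-- transition function -/
  P : S → A → stdSimplex ℝ S
  /-- upper bound on the rewards -/
  Rmax : ℝ
  /-- reward function -/
  R : S → A → ℝ
  R_nonneg : ∀ s a, 0 ≤ R s a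
  R_le : ∀ s a, R s a ≤ Rmax
  /-- discount factor -/
  γ : ℝ
  γ_nonneg : 0 ≤ γ
  γ_lt_one : γ < 1
  /-- initial state -/
  s₀ : S

variable {S A : Type*} [Fintype S] [Fintype A]

/-- `f(s, π) = E_{a ∼ π(·|s)} f(s, a)`. -/
def evalAt (f : S × A → ℝ) (s : S) (π : Policy S A) : ℝ :=
  ∑ a, (π s).1 a * f (s, a)

/-- The weighted squared 2-norm `‖f‖²_{2,ν} = E_ν[f²]`. -/
def normSq (ν f : S × A → ℝ) : ℝ := ∑ x, ν x * f x ^ 2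

namespace MDP

/-- `V_max = R_max / (1 - γ)`. -/
def Vmax (M : MDP S A) : ℝ := M.Rmax / (1 - M.γ)

/-- The Bellman operator `(T^π f)(s,a) = R(s,a) + γ E_{s' ∼ P(·|s,a)} f(s', π)`. -/
def bellman (M : MDP S A) (π : Policy S A) (f : S × A → ℝ) : S × A → ℝ :=
  fun x => M.R x.1 x.2 + M.γ * ∑ s', (M.P x.1 x.2).1 s' * evalAt f s' π

/-- The Bellman error `f - T^π f`. -/
def bellmanError (M : MDP S A) (π : Policy S A) (f : S × A → ℝ) : S × A → ℝ :=
  fun x => f x - M.bellman π f x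

open scoped Classical in
/-- `stepLaw π k (s, a)` is the probability that `s_k = s` and `a_k = a` when `π` is followed
from the initial state. -/
def stepLaw (M : MDP S A) (π : Policy S A) : ℕ → S × A → ℝ
  | 0 => fun x => (if x.1 = M.s₀ then 1 else 0) * (π x.1).1 x.2
  | k + 1 => fun x => (∑ y : S × A, stepLaw M π k y * (M.P y.1 y.2).1 x.1) * (π x.1).1 x.2

/-- Expected discounted return of a (possibly mixed) way of acting whose state-action pair at
time `k` has law `p k`. -/
def returnOf (M : MDP S A) (p : ℕ → S × A → ℝ) : ℝ :=
  ∑' k : ℕ, M.γ ^ k * ∑ x : S × A, p k x * M.R x.1 x.2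

/-- The expected discounted return `J(π)`. -/
def J (M : MDP S A) (π : Policy S A) : ℝ := M.returnOf (M.stepLaw π)

/-- The expected discounted return of the uniform mixture of `π 0, …, π (T-1)` at the level of
trajectories: one index is drawn uniformly at the start, and its policy is followed throughout,
so that the law at time `k` is the uniform mixture of the laws of the individual policies. -/
def mixtureJ (M : MDP S A) (T : ℕ) (π : ℕ → Policy S A) : ℝ :=
  M.returnOf fun k x => (1 / (T : ℝ)) * ∑ t ∈ Finset.range T, M.stepLaw (π t) k x

/-- The discounted state-action occupancy `d_π`. -/
def occupancy (M : MDP S A) (π : Policy S A) : S × A → ℝ :=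
  fun x => (1 - M.γ) * ∑' k : ℕ, M.γ ^ k * M.stepLaw π k x

/-- The law of one data tuple `(s, a, r, s')`, where `(s,a) ∼ μ`, `r = R(s,a)` and
`s' ∼ P(·|s,a)`. -/
def dataLaw [MeasurableSpace S] [MeasurableSpace A] (M : MDP S A) (μ : stdSimplex ℝ (S × A)) :
    Measure (S × A × ℝ × S) :=
  ∑ x : S × A, ∑ s' : S,
    ENNReal.ofReal (μ.1 x * (M.P x.1 x.2).1 s') • Measure.dirac (x.1, x.2, M.R x.1 x.2, s')

/-- The concentrability `C(ν; μ, F, π) = max_{f ∈ F} ‖f - T^π f‖²_{2,ν} / ‖f - T^π f‖²_{2,μ}`,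
with values in `[0, ∞]`; here `0/0 = 0` and `c/0 = ∞` for `c > 0`. -/
def concentrability (M : MDP S A) (ν μ : stdSimplex ℝ (S × A)) (F : Finset (S × A → ℝ))
    (π : Policy S A) : ℝ≥0∞ :=
  ⨆ f ∈ F, ENNReal.ofReal (normSq ν.1 (M.bellmanError π f)) /
    ENNReal.ofReal (normSq μ.1 (M.bellmanError π f))

/-- The admissible distributions: the data distribution and the occupancies of the policies in the
class. -/
def admissible (M : MDP S A) (μ : stdSimplex ℝ (S × A)) (Pol : Set (Policy S A)) :
    Set (S × A → ℝ) :=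
  insert μ.1 (M.occupancy '' Pol)

/-- Approximate realizability: for all policies `π` in the class,
`inf_{f ∈ F} sup_{ν admissible} ‖f - T^π f‖²_{2,ν} ≤ ε`. -/
def Realizability (M : MDP S A) (μ : stdSimplex ℝ (S × A)) (F : Finset (S × A → ℝ))
    (Pol : Set (Policy S A)) (ε : ℝ) : Prop :=
  ∀ π ∈ Pol, (⨅ f : {f // f ∈ F}, ⨆ ν : M.admissible μ Pol,
    normSq ν.1 (M.bellmanError π f.1)) ≤ ε

/-- Approximate completeness: for all policies `π` in the class,
`sup_{f ∈ F} inf_{f' ∈ F} ‖f' - T^π f‖²_{2,μ} ≤ ε`. -/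
def Completeness (M : MDP S A) (μ : stdSimplex ℝ (S × A)) (F : Finset (S × A → ℝ))
    (Pol : Set (Policy S A)) (ε : ℝ) : Prop :=
  ∀ π ∈ Pol, (⨆ f : {f // f ∈ F}, ⨅ f' : {f' // f' ∈ F},
    normSq μ.1 (fun x => f'.1 x - M.bellman π f.1 x)) ≤ ε

/-- The empirical squared loss `L(f', f, π; D)`. -/
def empLoss (M : MDP S A) {n : ℕ} (D : Fin n → S × A × ℝ × S) (f' f : S × A → ℝ)
    (π : Policy S A) : ℝ :=
  (1 / (n : ℝ)) * ∑ i, (f' ((D i).1, (D i).2.1) - (D i).2.2.1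
    - M.γ * evalAt f (D i).2.2.2 π) ^ 2

/-- The empirical Bellman error `E(f, π; D) = L(f, f, π; D) - min_{f' ∈ F} L(f', f, π; D)`. -/
def empBellmanError (M : MDP S A) (F : Finset (S × A → ℝ)) {n : ℕ}
    (D : Fin n → S × A × ℝ × S) (f : S × A → ℝ) (π : Policy S A) : ℝ :=
  M.empLoss D f f π - ⨅ f' : {f' // f' ∈ F}, M.empLoss D f'.1 f π

/-- `(f 0, …, f (T-1))` and `(π 0, …, π (T-1))` are the value functions and the policies produced
by `T` rounds of pessimistic soft policy iteration with parameters `lam` and `eta` on the data `D`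
(rounds are counted from `0`). Ties in the minimization may be broken in any way. -/
structure IsPSPIRun (M : MDP S A) (F : Finset (S × A → ℝ)) (lam eta : ℝ) (T : ℕ) {n : ℕ}
    (D : Fin n → S × A × ℝ × S) (f : ℕ → S × A → ℝ) (π : ℕ → Policy S A) : Prop where
  init : ∀ s a, (π 0 s).1 a = 1 / (Fintype.card A : ℝ)
  mem : ∀ t < T, f t ∈ F
  minimal : ∀ t < T, ∀ g ∈ F,
    evalAt (f t) M.s₀ (π t) + lam * M.empBellmanError F D (f t) (π t) ≤
      evalAt g M.s₀ (π t) + lam * M.empBellmanError F D g (π t)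
  update : ∀ t < T, ∀ s a, (π (t + 1) s).1 a =
    (π t s).1 a * Real.exp (eta * f t (s, a)) / ∑ b, (π t s).1 b * Real.exp (eta * f t (s, b))

/-- The off-support error at one round:
`min_{ν : C(ν; μ, F, π') ≤ C₂} |∑ (d_π ∖ ν)(s,a) [f(s,a) - (T^{π'} f)(s,a)] / (1 - γ)|`,
where `(d_π ∖ ν)(s,a) = max (d_π(s,a) - ν(s,a)) 0`. -/
def offSupport (M : MDP S A) (μ : stdSimplex ℝ (S × A)) (F : Finset (S × A → ℝ)) (C₂ : ℝ)
    (π π' : Policy S A) (f : S × A → ℝ) : ℝ :=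
  ⨅ ν : {ν : stdSimplex ℝ (S × A) // M.concentrability ν μ F π' ≤ ENNReal.ofReal C₂},
    |∑ x : S × A, max (M.occupancy π x - ν.1.1 x) 0 * M.bellmanError π' f x / (1 - M.γ)|

end MDP

/-- The implicit policy class of soft policy iteration: the policies
`π'(·|s) ∝ exp (eta ∑_{i=1}^t g_i(s,·))` with `1 ≤ t ≤ T` and `g_1, …, g_t ∈ F`. -/
def spiClass (F : Finset (S × A → ℝ)) (eta : ℝ) (T : ℕ) : Set (Policy S A) :=
  {π' | ∃ t : ℕ, 1 ≤ t ∧ t ≤ T ∧ ∃ g : Fin t → S × A → ℝ, (∀ i, g i ∈ F) ∧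
    ∀ s a, (π' s).1 a =
      Real.exp (eta * ∑ i, g i (s, a)) / ∑ b, Real.exp (eta * ∑ i, g i (s, b))}

/-- The threshold `ε_r = 139 V_max² log (|F||Π| / δ) / n + 39 ε_F`. -/
def epsR (Vmax : ℝ) (cardF cardPol n : ℕ) (δ εF : ℝ) : ℝ :=
  139 * Vmax ^ 2 * Real.log ((cardF : ℝ) * cardPol / δ) / n + 39 * εF

end OfflineRL

end

set_option linter.unusedSectionVars false

/-! For each round, split `J π - J (πs t)` into `J π - f_t(s₀, π_t)` and the overestimation `f_t(s₀,
π_t) - J (πs t)`.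

Overestimation is controlled by pessimism. Realizability supplies `g ∈ F` with small Bellman error
under both `μ` and the occupancy of `π_t`. So `g(s₀, π_t)` nearly equals `J (πs t)`, while its
empirical Bellman error is at most `ε_r`. As `f_t` minimizes the penalized objective, it
overestimates by at most `√ε_F / (1 - γ) + λ ε_r`. The same comparison gives `E(f_t) ≤ 2 V_max / λ`,
hence a small Bellman error of `f_t` under `μ` (`IsPSPIRun.round_bounds`).

The other part is, by the performance difference identity `J_sub_evalAt`, minus the Bellman error of
`f_t` under `d_π`, plus the advantage of `π` over `π_t` as measured by `f_t`. The first is compared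
with a covered `ν`, leaving the off-support term (`neg_sum_occupancy_bellmanError_le`). The second,
summed over rounds, is the regret of exponential weights in each state (`IsPSPIRun.regret`).

The data enter through `exists_uniform_concentration`. The excess loss over the Bellman backup has
mean `‖f' - T^π f‖²` under `μ` and second moment at most `4 V_max²` times that mean, so deviations
have the fast rate `1/n`. The iterates depend on the data, but every policy after the first lies in
the finite class `spiClass`, of size at most `T |F|^T`; a union bound thus costs order `T
log(|F|/δ)`. The choice of `λ` equates `√(V_max / λ) / (1 - γ)` with `λ ε_r`, which produces the
cube roots (`penalty_scale`).

The uniform first policy need not belong to the class. That round is bounded trivially, and its cost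
is absorbed by the regret term. -/

namespace OfflineRL

/-! ### Weighted averages, occupancy measures and performance difference -/

section Basic
variable {S A : Type*} [Fintype S] [Fintype A]

lemma simplex_nonneg {ι : Type*} [Fintype ι] (p : stdSimplex ℝ ι) (i : ι) : 0 ≤ p.1 i := p.2.1 i

lemma simplex_sum {ι : Type*} [Fintype ι] (p : stdSimplex ℝ ι) : ∑ i, p.1 i = 1 := p.2.2

lemma weighted_sum_mem_Icc {ι : Type*} [Fintype ι] {p g : ι → ℝ} {a b : ℝ}
    (hp : ∀ i, 0 ≤ p i) (hsum : ∑ i, p i = 1) (hg : ∀ i, a ≤ g i ∧ g i ≤ b) :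
    a ≤ ∑ i, p i * g i ∧ ∑ i, p i * g i ≤ b := by
  constructor
  · calc a = ∑ i, p i * a := by rw [← Finset.sum_mul, hsum, one_mul]
      _ ≤ _ := Finset.sum_le_sum fun i _ => mul_le_mul_of_nonneg_left (hg i).1 (hp i)
  · calc _ ≤ ∑ i, p i * b :=
          Finset.sum_le_sum fun i _ => mul_le_mul_of_nonneg_left (hg i).2 (hp i)
      _ = b := by rw [← Finset.sum_mul, hsum, one_mul]

/-- Cauchy–Schwarz for the vectors `√ν` and `√ν |g|`; the first has norm one. -/
lemma weighted_abs_le_sqrt_normSq {ν g : S × A → ℝ} (hν : ∀ x, 0 ≤ ν x) (hsum : ∑ x, ν x = 1) :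
    ∑ x, ν x * |g x| ≤ √(normSq ν g) := by
  apply Real.le_sqrt_of_sq_le
  have := Finset.sum_mul_sq_le_sq_mul_sq Finset.univ (fun x => √(ν x)) (fun x => √(ν x) * |g x|)
  have e1 : ∀ x, √(ν x) * (√(ν x) * |g x|) = ν x * |g x| := fun x => by
    rw [← mul_assoc, Real.mul_self_sqrt (hν x)]
  have e2 : ∀ x, (√(ν x) * |g x|) ^ 2 = ν x * g x ^ 2 := fun x => by
    rw [mul_pow, Real.sq_sqrt (hν x), sq_abs]
  simp only [e1, e2, Real.sq_sqrt (hν _), hsum, one_mul] at this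
  exact this

lemma normSq_nonneg {ν : S × A → ℝ} (hν : ∀ x, 0 ≤ ν x) (g : S × A → ℝ) : 0 ≤ normSq ν g :=
  Finset.sum_nonneg fun x _ => mul_nonneg (hν x) (sq_nonneg _)

lemma evalAt_mem_Icc {f : S × A → ℝ} {a b : ℝ} (hf : ∀ x, a ≤ f x ∧ f x ≤ b) (s : S)
    (π : Policy S A) : a ≤ evalAt f s π ∧ evalAt f s π ≤ b :=
  weighted_sum_mem_Icc (simplex_nonneg _) (simplex_sum _) fun _ => hf _

namespace MDP
variable (M : MDP S A)

lemma one_sub_γ_pos : 0 < 1 - M.γ := sub_pos.2 M.γ_lt_one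

lemma Rmax_nonneg (a : A) : 0 ≤ M.Rmax := (M.R_nonneg M.s₀ a).trans (M.R_le _ _)

lemma Vmax_mul : M.Vmax * (1 - M.γ) = M.Rmax :=
  div_mul_cancel₀ _ M.one_sub_γ_pos.ne'

lemma Vmax_nonneg (a : A) : 0 ≤ M.Vmax := div_nonneg (M.Rmax_nonneg a) M.one_sub_γ_pos.le

lemma bellman_mem_Icc {f : S × A → ℝ} (hf : ∀ x, 0 ≤ f x ∧ f x ≤ M.Vmax) (π : Policy S A)
    (x : S × A) : 0 ≤ M.bellman π f x ∧ M.bellman π f x ≤ M.Vmax := by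
  have h := weighted_sum_mem_Icc (simplex_nonneg (M.P x.1 x.2)) (simplex_sum _)
    fun s' => evalAt_mem_Icc hf s' π
  have := M.Vmax_mul
  have h1 := M.R_nonneg x.1 x.2
  have h2 := M.R_le x.1 x.2
  have h3 := mul_nonneg M.γ_nonneg h.1
  have h4 := mul_le_mul_of_nonneg_left h.2 M.γ_nonneg
  unfold bellman
  constructor <;> nlinarith

lemma stepLaw_nonneg (π : Policy S A) (k : ℕ) (x : S × A) : 0 ≤ M.stepLaw π k x := by
  induction k generalizing x with
  | zero =>
    unfold stepLaw
    exact mul_nonneg (by split_ifs <;> norm_num) (simplex_nonneg _ _)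
  | succ k ih =>
    unfold stepLaw
    exact mul_nonneg (Finset.sum_nonneg fun y _ => mul_nonneg (ih y) (simplex_nonneg _ _))
      (simplex_nonneg _ _)

lemma sum_stepLaw_zero_mul (π : Policy S A) (g : S × A → ℝ) :
    ∑ x, M.stepLaw π 0 x * g x = evalAt g M.s₀ π := by
  classical
  rw [Fintype.sum_prod_type, Finset.sum_eq_single M.s₀]
  · simp [stepLaw, evalAt]
  · intro s _ hs
    simp [stepLaw, hs]
  · simp

/-- The Markov property in weak form. Testing against functions lets the total mass and the flow
equation be derived without manipulating the laws pointwise. -/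
lemma sum_stepLaw_succ_mul (π : Policy S A) (k : ℕ) (g : S × A → ℝ) :
    ∑ x, M.stepLaw π (k + 1) x * g x =
      ∑ y, M.stepLaw π k y * ∑ s', (M.P y.1 y.2).1 s' * evalAt g s' π := by
  simp only [stepLaw, evalAt]
  rw [Fintype.sum_prod_type]
  simp only [Finset.sum_mul, Finset.mul_sum]
  rw [Finset.sum_comm_cycle]
  refine Finset.sum_congr rfl fun y _ => Finset.sum_congr rfl fun s' _ =>
    Finset.sum_congr rfl fun a _ => by ring

lemma sum_stepLaw (π : Policy S A) (k : ℕ) : ∑ x, M.stepLaw π k x = 1 := by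
  induction k with
  | zero => simpa only [mul_one, evalAt, simplex_sum] using M.sum_stepLaw_zero_mul π fun _ => 1
  | succ k ih =>
    have := M.sum_stepLaw_succ_mul π k fun _ => 1
    simpa [evalAt, simplex_sum, ih] using this

lemma stepLaw_le_one (π : Policy S A) (k : ℕ) (x : S × A) : M.stepLaw π k x ≤ 1 := by
  rw [← M.sum_stepLaw π k]
  exact Finset.single_le_sum (fun y _ => M.stepLaw_nonneg π k y) (Finset.mem_univ x)

lemma summable_stepLaw (π : Policy S A) (x : S × A) :
    Summable fun k : ℕ => M.γ ^ k * M.stepLaw π k x :=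
  Summable.of_nonneg_of_le
    (fun k => mul_nonneg (pow_nonneg M.γ_nonneg k) (M.stepLaw_nonneg π k x))
    (fun k => mul_le_of_le_one_right (pow_nonneg M.γ_nonneg k) (M.stepLaw_le_one π k x))
    (summable_geometric_of_lt_one M.γ_nonneg M.γ_lt_one)

lemma hasSum_stepLaw_mul (π : Policy S A) (g : S × A → ℝ) :
    HasSum (fun k : ℕ => M.γ ^ k * ∑ x, M.stepLaw π k x * g x)
      ((∑ x, M.occupancy π x * g x) / (1 - M.γ)) := by
  have h : HasSum (fun k : ℕ => ∑ x, M.γ ^ k * M.stepLaw π k x * g x)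
      (∑ x, (∑' k : ℕ, M.γ ^ k * M.stepLaw π k x) * g x) :=
    hasSum_sum fun x _ => (M.summable_stepLaw π x).hasSum.mul_right _
  convert h using 1
  · ext k
    rw [Finset.mul_sum]
    exact Finset.sum_congr rfl fun x _ => by ring
  · rw [Finset.sum_div]
    refine Finset.sum_congr rfl fun x _ => ?_
    have := M.one_sub_γ_pos.ne'
    unfold occupancy
    field_simp

lemma occupancy_nonneg (π : Policy S A) (x : S × A) : 0 ≤ M.occupancy π x :=
  mul_nonneg M.one_sub_γ_pos.le
    (tsum_nonneg fun k => mul_nonneg (pow_nonneg M.γ_nonneg k) (M.stepLaw_nonneg π k x))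

lemma sum_occupancy (π : Policy S A) : ∑ x, M.occupancy π x = 1 := by
  have h := M.hasSum_stepLaw_mul π fun _ => 1
  simp only [mul_one, M.sum_stepLaw] at h
  have h2 := h.unique (hasSum_geometric_of_lt_one M.γ_nonneg M.γ_lt_one)
  have := M.one_sub_γ_pos.ne'
  field_simp at h2
  exact h2

lemma J_eq (π : Policy S A) :
    M.J π = (∑ x, M.occupancy π x * M.R x.1 x.2) / (1 - M.γ) :=
  (M.hasSum_stepLaw_mul π fun x => M.R x.1 x.2).tsum_eq

lemma J_mem_Icc (π : Policy S A) : 0 ≤ M.J π ∧ M.J π ≤ M.Vmax := by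
  have h := weighted_sum_mem_Icc (M.occupancy_nonneg π) (M.sum_occupancy π)
    fun x => ⟨M.R_nonneg x.1 x.2, M.R_le x.1 x.2⟩
  rw [J_eq]
  exact ⟨div_nonneg h.1 M.one_sub_γ_pos.le,
    div_le_div_of_nonneg_right h.2 M.one_sub_γ_pos.le⟩

lemma mixtureJ_eq (T : ℕ) (π : ℕ → Policy S A) :
    M.mixtureJ T π = (1 / (T : ℝ)) * ∑ t ∈ Finset.range T, M.J (π t) := by
  have h : HasSum (fun k : ℕ => (1 / (T : ℝ)) *
      ∑ t ∈ Finset.range T, M.γ ^ k * ∑ x, M.stepLaw (π t) k x * M.R x.1 x.2)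
      ((1 / (T : ℝ)) * ∑ t ∈ Finset.range T, M.J (π t)) := by
    refine (hasSum_sum fun t _ => ?_).mul_left _
    rw [J_eq]
    exact M.hasSum_stepLaw_mul (π t) fun x => M.R x.1 x.2
  unfold mixtureJ returnOf
  rw [← h.tsum_eq]
  refine tsum_congr fun k => ?_
  simp only [Finset.mul_sum, Finset.sum_mul]
  rw [Finset.sum_comm]
  refine Finset.sum_congr rfl fun t _ => Finset.sum_congr rfl fun x _ => by ring

/-- Flow equation of the occupancy measure, tested against a function `g`. -/
lemma occupancy_flow (π : Policy S A) (g : S × A → ℝ) :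
    evalAt g M.s₀ π = (∑ x, M.occupancy π x *
      (g x - M.γ * ∑ s', (M.P x.1 x.2).1 s' * evalAt g s' π)) / (1 - M.γ) := by
  have h1 := M.hasSum_stepLaw_mul π g
  have h2 := (M.hasSum_stepLaw_mul π
    fun x => ∑ s', (M.P x.1 x.2).1 s' * evalAt g s' π).mul_left M.γ
  have h3 := (hasSum_nat_add_iff' 1).2 h1
  -- Removing the term `k = 0` from the discounted series leaves `γ` times the series of the
  -- one-step expectations.
  have h4 : (fun k : ℕ => M.γ ^ (k + 1) * ∑ x, M.stepLaw π (k + 1) x * g x) = fun k : ℕ =>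
      M.γ * (M.γ ^ k * ∑ x, M.stepLaw π k x * ∑ s', (M.P x.1 x.2).1 s' * evalAt g s' π) := by
    ext k
    rw [sum_stepLaw_succ_mul]
    ring
  rw [h4] at h3
  have h5 := h3.unique h2
  simp only [Finset.sum_range_one, pow_zero, one_mul, sum_stepLaw_zero_mul] at h5
  have h6 : ∑ x, M.occupancy π x * (g x - M.γ * ∑ s', (M.P x.1 x.2).1 s' * evalAt g s' π) =
      ∑ x, M.occupancy π x * g x -
        M.γ * ∑ x, M.occupancy π x * ∑ s', (M.P x.1 x.2).1 s' * evalAt g s' π := by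
    rw [Finset.mul_sum, ← Finset.sum_sub_distrib]
    exact Finset.sum_congr rfl fun x _ => by ring
  rw [h6, sub_div, mul_div_assoc]
  linarith

/-- The flow equation tested on `f` itself; subtracting the rewards turns the integrand into the
Bellman error. -/
lemma evalAt_sub_J (π : Policy S A) (f : S × A → ℝ) :
    evalAt f M.s₀ π - M.J π = (∑ x, M.occupancy π x * M.bellmanError π f x) / (1 - M.γ) := by
  rw [occupancy_flow, J_eq, ← sub_div, ← Finset.sum_sub_distrib]
  congr 1
  refine Finset.sum_congr rfl fun x _ => ?_
  unfold bellmanError bellman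
  ring

lemma evalAt_sub_J_le (π : Policy S A) (f : S × A → ℝ) :
    evalAt f M.s₀ π - M.J π ≤ √(normSq (M.occupancy π) (M.bellmanError π f)) / (1 - M.γ) := by
  rw [evalAt_sub_J]
  refine div_le_div_of_nonneg_right ?_ M.one_sub_γ_pos.le
  refine le_trans ?_ (weighted_abs_le_sqrt_normSq (M.occupancy_nonneg π) (M.sum_occupancy π))
  exact Finset.sum_le_sum fun x _ => mul_le_mul_of_nonneg_left (le_abs_self _)
    (M.occupancy_nonneg π x)

/-- Performance difference of `π` against the prediction of `f` for `π'`. -/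
lemma J_sub_evalAt (π π' : Policy S A) (f : S × A → ℝ) :
    M.J π - evalAt f M.s₀ π' =
      (-∑ x, M.occupancy π x * M.bellmanError π' f x) / (1 - M.γ) +
      (∑ x, M.occupancy π x * (evalAt f x.1 π - evalAt f x.1 π')) / (1 - M.γ) := by
  have h1 := M.evalAt_sub_J π f
  -- The test function is the advantage of `π` over `π'`. It depends on the state only, so averaging
  -- it over the actions of `π` leaves it unchanged.
  have h2 := M.occupancy_flow π fun x => evalAt f x.1 π - evalAt f x.1 π'
  have h3 : ∀ s, evalAt (fun x : S × A => evalAt f x.1 π - evalAt f x.1 π') s π =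
      evalAt f s π - evalAt f s π' := fun s => by
    change ∑ a, (π s).1 a * (evalAt f s π - evalAt f s π') = _
    rw [← Finset.sum_mul, simplex_sum, one_mul]
  simp only [h3] at h2
  have h4 : M.J π - evalAt f M.s₀ π' =
      (evalAt f M.s₀ π - evalAt f M.s₀ π') - (evalAt f M.s₀ π - M.J π) := by ring
  rw [h4, h1, h2, ← sub_div, ← add_div, ← Finset.sum_sub_distrib, neg_add_eq_sub,
    ← Finset.sum_sub_distrib]
  congr 1
  refine Finset.sum_congr rfl fun x _ => ?_
  have h5 : ∑ s', (M.P x.1 x.2).1 s' * (evalAt f s' π - evalAt f s' π') =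
      ∑ s', (M.P x.1 x.2).1 s' * evalAt f s' π - ∑ s', (M.P x.1 x.2).1 s' * evalAt f s' π' := by
    rw [← Finset.sum_sub_distrib]
    exact Finset.sum_congr rfl fun _ _ => by ring
  unfold bellmanError bellman
  rw [h5]
  ring

lemma normSq_le_of_concentrability {ν μ : stdSimplex ℝ (S × A)} {F : Finset (S × A → ℝ)}
    {π : Policy S A} {C₂ : ℝ} (hC : 0 ≤ C₂)
    (h : M.concentrability ν μ F π ≤ ENNReal.ofReal C₂) {f : S × A → ℝ} (hf : f ∈ F) :
    normSq ν.1 (M.bellmanError π f) ≤ C₂ * normSq μ.1 (M.bellmanError π f) := by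
  have h1 : ENNReal.ofReal (normSq ν.1 (M.bellmanError π f)) /
      ENNReal.ofReal (normSq μ.1 (M.bellmanError π f)) ≤ ENNReal.ofReal C₂ :=
    le_trans (le_iSup₂ (f := fun f (_ : f ∈ F) =>
      ENNReal.ofReal (normSq ν.1 (M.bellmanError π f)) /
        ENNReal.ofReal (normSq μ.1 (M.bellmanError π f))) f hf) h
  have hμ := normSq_nonneg (simplex_nonneg μ) (M.bellmanError π f)
  rw [ENNReal.div_le_iff_le_mul (Or.inr ENNReal.ofReal_ne_top) (Or.inl ENNReal.ofReal_ne_top),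
    ← ENNReal.ofReal_mul hC] at h1
  exact (ENNReal.ofReal_le_ofReal_iff (mul_nonneg hC hμ)).1 h1

lemma concentrability_self_le (μ : stdSimplex ℝ (S × A)) (F : Finset (S × A → ℝ))
    (π : Policy S A) {C₂ : ℝ} (hC : 1 ≤ C₂) :
    M.concentrability μ μ F π ≤ ENNReal.ofReal C₂ := by
  refine iSup₂_le fun f _ => ENNReal.div_self_le_one.trans ?_
  rw [← ENNReal.ofReal_one]
  exact ENNReal.ofReal_le_ofReal hC

lemma offSupport_nonneg (μ : stdSimplex ℝ (S × A)) (F : Finset (S × A → ℝ)) (C₂ : ℝ)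
    (π π' : Policy S A) (f : S × A → ℝ) : 0 ≤ M.offSupport μ F C₂ π π' f :=
  Real.iInf_nonneg fun _ => abs_nonneg _

/-- Splitting the Bellman error under `d_π` into the part covered by a distribution of bounded
concentrability and the off-support part. -/
lemma neg_sum_occupancy_bellmanError_le {μ : stdSimplex ℝ (S × A)} {F : Finset (S × A → ℝ)}
    {C₂ : ℝ} (hC : 1 ≤ C₂) (π π' : Policy S A) {f : S × A → ℝ} (hf : f ∈ F) :
    (-∑ x, M.occupancy π x * M.bellmanError π' f x) / (1 - M.γ) ≤
      √(C₂ * normSq μ.1 (M.bellmanError π' f)) / (1 - M.γ) + M.offSupport μ F C₂ π π' f := by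
  -- The infimum in `offSupport` is over a non-empty set: `μ` has concentrability at most one with
  -- respect to itself, and `1 ≤ C₂`.
  have : Nonempty {ν : stdSimplex ℝ (S × A) //
      M.concentrability ν μ F π' ≤ ENNReal.ofReal C₂} :=
    ⟨⟨μ, M.concentrability_self_le μ F π' hC⟩⟩
  rw [← sub_le_iff_le_add']
  refine le_ciInf fun ν => ?_
  rw [sub_le_iff_le_add', ← Finset.sum_div]
  refine le_trans ?_ (add_le_add_right (neg_le_abs _) _)
  rw [← neg_div, ← add_div]
  refine div_le_div_of_nonneg_right ?_ M.one_sub_γ_pos.le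
  have h1 : ∑ x, ν.1.1 x * |M.bellmanError π' f x| ≤
      √(C₂ * normSq μ.1 (M.bellmanError π' f)) :=
    (weighted_abs_le_sqrt_normSq (simplex_nonneg ν.1) (simplex_sum ν.1)).trans
      (Real.sqrt_le_sqrt (M.normSq_le_of_concentrability (zero_le_one.trans hC) ν.2 hf))
  refine le_trans ?_ (add_le_add_left h1 _)
  rw [← Finset.sum_neg_distrib, ← Finset.sum_neg_distrib, ← Finset.sum_add_distrib]
  -- Pointwise, with Bellman error `e`: `-d e ≤ ν |e| - max (d - ν) 0 * e`. If `d ≤ ν` the last term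
  -- vanishes; otherwise `d = ν + (d - ν)`.
  refine Finset.sum_le_sum fun x _ => ?_
  have hd := M.occupancy_nonneg π x
  have hn := simplex_nonneg ν.1 x
  have ha := neg_le_abs (M.bellmanError π' f x)
  have ha' := abs_nonneg (M.bellmanError π' f x)
  rcases le_total (M.occupancy π x) (ν.1.1 x) with h | h
  · rw [max_eq_right (by linarith)]
    nlinarith
  · rw [max_eq_left (by linarith)]
    nlinarith

end MDP
end Basic
-- Exponential weights and the implicit policy class
section SoftPolicy
variable {S A : Type*} [Fintype S] [Fintype A]

lemma sum_exp_pos [Nonempty A] (h : A → ℝ) : 0 < ∑ b, Real.exp (h b) :=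
  Finset.sum_pos (fun _ _ => Real.exp_pos _) Finset.univ_nonempty

/-- The policy `π(·|s) ∝ exp (h(s,·))`. -/
noncomputable def softmaxPolicy [Nonempty A] (h : S × A → ℝ) : Policy S A := fun s =>
  ⟨fun a => Real.exp (h (s, a)) / ∑ b, Real.exp (h (s, b)),
    fun _ => div_nonneg (Real.exp_pos _).le (sum_exp_pos _).le, by
      rw [← Finset.sum_div, div_self (sum_exp_pos _).ne']⟩

lemma exp_le_one_add_add_sq {x : ℝ} (hx : |x| ≤ 1) : Real.exp x ≤ 1 + x + x ^ 2 := by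
  have := (abs_le.1 (Real.abs_exp_sub_one_sub_id_le hx)).2
  linarith

/-- Regret of exponential weights with gains in `[0, V]`. -/
lemma exponential_weights_regret [Nonempty A] {η V : ℝ} (hη : 0 ≤ η) (hηV : η * V ≤ 1)
    (T : ℕ) (g p : ℕ → A → ℝ) (hg : ∀ t < T, ∀ a, 0 ≤ g t a ∧ g t a ≤ V)
    (hp : ∀ t < T, ∀ a, p t a = Real.exp (η * ∑ i ∈ Finset.range t, g i a) /
      ∑ b, Real.exp (η * ∑ i ∈ Finset.range t, g i b)) (q : stdSimplex ℝ A) :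
    η * ∑ t ∈ Finset.range T, (∑ a, q.1 a * g t a - ∑ a, p t a * g t a) ≤
      Real.log (Fintype.card A) + T * (η * V) ^ 2 := by
  -- The potential is the normalizing constant `W`. Its logarithm starts at `log |A|`, grows by at
  -- most the gain of `p t` plus a quadratic term in each round, and finally dominates the total
  -- gain of every single action, hence of `q`.
  set W : ℕ → ℝ := fun t => ∑ a, Real.exp (η * ∑ i ∈ Finset.range t, g i a) with hW
  have hWpos : ∀ t, 0 < W t := fun t => sum_exp_pos _
  have upper : ∀ t ≤ T, Real.log (W t) ≤ Real.log (Fintype.card A) +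
      η * ∑ i ∈ Finset.range t, ∑ a, p i a * g i a + t * (η * V) ^ 2 := by
    intro t
    induction t with
    | zero => intro _; simp [hW]
    | succ t ih =>
      intro ht
      have ht' : t < T := ht
      have hp0 : ∀ a, 0 ≤ p t a := fun a => by
        rw [hp t ht']
        exact div_nonneg (Real.exp_pos _).le (hWpos t).le
      have hp1 : ∑ a, p t a = 1 := by
        simp_rw [hp t ht']
        rw [← Finset.sum_div]
        exact div_self (hWpos t).ne'
      have hstep : W (t + 1) = W t * ∑ a, p t a * Real.exp (η * g t a) := by
        rw [Finset.mul_sum]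
        refine Finset.sum_congr rfl fun a _ => ?_
        rw [hp t ht', Finset.sum_range_succ, mul_add, Real.exp_add, ← mul_assoc,
          mul_div_cancel₀ _ (hWpos t).ne']
      have hS : ∑ a, p t a * Real.exp (η * g t a) ≤
          1 + (η * ∑ a, p t a * g t a + (η * V) ^ 2) := by
        calc _ ≤ ∑ a, p t a * (1 + (η * g t a + (η * V) ^ 2)) := by
              refine Finset.sum_le_sum fun a _ => mul_le_mul_of_nonneg_left ?_ (hp0 a)
              obtain ⟨h0, h1⟩ := hg t ht' a
              have h2 : 0 ≤ η * g t a := mul_nonneg hη h0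
              have h3 : η * g t a ≤ η * V := mul_le_mul_of_nonneg_left h1 hη
              have h4 := exp_le_one_add_add_sq (x := η * g t a)
                (by rw [abs_of_nonneg h2]; linarith)
              have h5 := pow_le_pow_left₀ h2 h3 2
              linarith
          _ = _ := by
              simp only [mul_add, Finset.sum_add_distrib, ← Finset.sum_mul, mul_one, hp1,
                one_mul, Finset.mul_sum]
              congr 2
              exact Finset.sum_congr rfl fun a _ => by ring
      have hSpos : 0 < ∑ a, p t a * Real.exp (η * g t a) := by
        have := hWpos (t + 1)
        rw [hstep] at this
        exact pos_of_mul_pos_right this (hWpos t).le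
      have hlog : Real.log (∑ a, p t a * Real.exp (η * g t a)) ≤
          η * ∑ a, p t a * g t a + (η * V) ^ 2 := by
        have := Real.log_le_sub_one_of_pos hSpos
        linarith
      rw [hstep, Real.log_mul (hWpos t).ne' hSpos.ne', Finset.sum_range_succ, mul_add]
      push_cast
      have := ih ht'.le
      linarith
  have lower : η * ∑ t ∈ Finset.range T, ∑ a, q.1 a * g t a ≤ Real.log (W T) := by
    have h := fun a => (Real.le_log_iff_exp_le (hWpos T)).2
      (Finset.single_le_sum (f := fun a => Real.exp (η * ∑ i ∈ Finset.range T, g i a))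
        (fun _ _ => (Real.exp_pos _).le) (Finset.mem_univ a))
    have h2 := Finset.sum_le_sum fun a (_ : a ∈ Finset.univ) =>
      mul_le_mul_of_nonneg_left (h a) (simplex_nonneg q a)
    rw [← Finset.sum_mul, simplex_sum, one_mul] at h2
    refine le_trans (le_of_eq ?_) h2
    simp only [Finset.mul_sum]
    rw [Finset.sum_comm]
    exact Finset.sum_congr rfl fun _ _ => Finset.sum_congr rfl fun _ _ => by ring
  have := upper T le_rfl
  rw [Finset.sum_sub_distrib, mul_sub]
  linarith

/-- A policy of the class is determined by its finite sequence of functions. Lengths run from `1` to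
`T`, so the index in `Fin T` is the length minus one. -/
lemma spiClass_subset_range [Nonempty A] (F : Finset (S × A → ℝ)) (eta : ℝ) (T : ℕ) :
    spiClass F eta T ⊆ Set.range fun u : (t : Fin T) × (Fin (t + 1) → F) =>
      softmaxPolicy fun x => eta * ∑ i, (u.2 i).1 x := by
  rintro π' ⟨t, h1, hT, g, hg, h⟩
  obtain ⟨k, rfl⟩ : ∃ k, t = k + 1 := ⟨t - 1, by omega⟩
  refine ⟨⟨⟨k, by omega⟩, fun i => ⟨g i, hg i⟩⟩, ?_⟩
  funext s
  apply Subtype.ext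
  funext a
  exact (h s a).symm

lemma spiClass_finite [Nonempty A] (F : Finset (S × A → ℝ)) (eta : ℝ) (T : ℕ) :
    (spiClass F eta T).Finite :=
  (Set.finite_range _).subset (spiClass_subset_range F eta T)

lemma spiClass_nonempty [Nonempty A] {F : Finset (S × A → ℝ)} (hF : F.Nonempty) (eta : ℝ)
    {T : ℕ} (hT : 0 < T) : (spiClass F eta T).Nonempty := by
  obtain ⟨f, hf⟩ := hF
  exact ⟨softmaxPolicy fun x => eta * ∑ _i : Fin 1, f x, 1, le_rfl, hT, fun _ => f,
    fun _ => hf, fun _ _ => rfl⟩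

lemma spiClass_ncard_le [Nonempty A] {F : Finset (S × A → ℝ)} (hF : F.Nonempty) (eta : ℝ)
    (T : ℕ) : (spiClass F eta T).ncard ≤ T * F.card ^ T := by
  refine (Set.ncard_le_ncard (spiClass_subset_range F eta T) (Set.finite_range _)).trans ?_
  rw [← Set.image_univ]
  refine (Set.ncard_image_le Set.finite_univ).trans ?_
  rw [Set.ncard_univ, Nat.card_eq_fintype_card, Fintype.card_sigma]
  calc _ ≤ ∑ _t : Fin T, F.card ^ T := Finset.sum_le_sum fun t _ => by
        simpa using Nat.pow_le_pow_right hF.card_pos (by omega : t.1 + 1 ≤ T)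
    _ = _ := by simp

namespace MDP
namespace IsPSPIRun
variable {M : MDP S A} {F : Finset (S × A → ℝ)} {lam eta : ℝ} {T n : ℕ}
  {D : Fin n → S × A × ℝ × S} {f : ℕ → S × A → ℝ} {π : ℕ → Policy S A}

/-- The normalizing constants of the successive updates cancel. At `t = 0` the empty sum gives the
uniform policy. -/
lemma policy_eq [Nonempty A] (h : M.IsPSPIRun F lam eta T D f π) {t : ℕ} (ht : t ≤ T) (s : S)
    (a : A) : (π t s).1 a = Real.exp (eta * ∑ i ∈ Finset.range t, f i (s, a)) /
      ∑ b, Real.exp (eta * ∑ i ∈ Finset.range t, f i (s, b)) := by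
  induction t generalizing a with
  | zero => simp [h.init s a]
  | succ t ih =>
    have ht' : t < T := ht
    have hpos := sum_exp_pos fun b => eta * ∑ i ∈ Finset.range t, f i (s, b)
    have e : ∀ b, (π t s).1 b * Real.exp (eta * f t (s, b)) =
        Real.exp (eta * ∑ i ∈ Finset.range (t + 1), f i (s, b)) /
          ∑ b, Real.exp (eta * ∑ i ∈ Finset.range t, f i (s, b)) := fun b => by
      rw [ih ht'.le, Finset.sum_range_succ, mul_add, Real.exp_add]
      ring
    rw [h.update t ht' s a]
    simp only [e]
    rw [← Finset.sum_div, div_div_div_cancel_right₀ hpos.ne']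

lemma policy_mem [Nonempty A] (h : M.IsPSPIRun F lam eta T D f π) {t : ℕ} (h0 : 0 < t)
    (ht : t ≤ T) : π t ∈ spiClass F eta T := by
  refine ⟨t, h0, ht, fun i => f i, fun i => h.mem i (by omega), fun s a => ?_⟩
  simp only [h.policy_eq ht, Finset.sum_range]

/-- With this step size, `log |A| = 2 T (eta V)²`, so exponential weights give `3 T V (eta V)`,
where `eta V ≤ √(log |A| / T)`. If `eta V > 1` that square root exceeds one and the trivial bound `T
V` suffices. -/
lemma regret [Nonempty A] (h : M.IsPSPIRun F lam eta T D f π) (hV : 0 < M.Vmax) (hT : 0 < T)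
    (hA : 0 < Real.log (Fintype.card A))
    (hF : ∀ f ∈ F, ∀ x, 0 ≤ f x ∧ f x ≤ M.Vmax)
    (heta : eta = √(Real.log (Fintype.card A) / (2 * M.Vmax ^ 2 * T)))
    (s : S) (π' : Policy S A) :
    ∑ t ∈ Finset.range T, (evalAt (f t) s π' - evalAt (f t) s (π t)) ≤
      3 * (M.Vmax * T * √(Real.log (Fintype.card A) / T)) := by
  have hT' : (0 : ℝ) < T := Nat.cast_pos.2 hT
  set V := M.Vmax
  set ℓ := Real.log (Fintype.card A)
  set r := √(ℓ / T) with hr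
  have hr0 : 0 < r := Real.sqrt_pos.2 (div_pos hA hT')
  have hr2 : r ^ 2 = ℓ / T := Real.sq_sqrt (div_pos hA hT').le
  have hη : 0 < eta := by rw [heta]; positivity
  have hη2 : eta ^ 2 = ℓ / (2 * V ^ 2 * T) := by rw [heta, Real.sq_sqrt (by positivity)]
  have hh2 : 2 * (eta * V) ^ 2 = r ^ 2 := by
    rw [hr2, mul_pow, hη2]
    field_simp
  have hh : 0 < eta * V := mul_pos hη hV
  have hhr : eta * V ≤ r := by nlinarith
  by_cases hle : eta * V ≤ 1
  · have key := exponential_weights_regret hη.le hle T (fun t a => f t (s, a))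
      (fun t a => (π t s).1 a) (fun t ht a => hF _ (h.mem t ht) _)
      (fun t ht a => h.policy_eq ht.le s a) (π' s)
    change eta * ∑ t ∈ Finset.range T, (evalAt (f t) s π' - evalAt (f t) s (π t)) ≤
      ℓ + T * (eta * V) ^ 2 at key
    set reg := ∑ t ∈ Finset.range T, (evalAt (f t) s π' - evalAt (f t) s (π t))
    have hℓ : ℓ = T * (2 * (eta * V) ^ 2) := by
      rw [hh2, hr2]
      field_simp
    have h1 : eta * reg ≤ eta * (3 * (V * T * (eta * V))) := by
      rw [hℓ] at key
      linarith
    have h2 := le_of_mul_le_mul_left h1 hη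
    have h3 : V * T * (eta * V) ≤ V * T * r := mul_le_mul_of_nonneg_left hhr (by positivity)
    linarith
  · have h1 : ∀ t ∈ Finset.range T, evalAt (f t) s π' - evalAt (f t) s (π t) ≤ V := by
      intro t ht
      have hb := hF _ (h.mem t (Finset.mem_range.1 ht))
      have h1 := (evalAt_mem_Icc hb s π').2
      have h2 := (evalAt_mem_Icc hb s (π t)).1
      linarith
    have h2 := Finset.sum_le_sum h1
    rw [Finset.sum_const, Finset.card_range, nsmul_eq_mul] at h2
    have h3 : 1 ≤ r := by linarith
    have h4 : V * T * 1 ≤ V * T * r := mul_le_mul_of_nonneg_left h3 (by positivity)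
    have h5 : 0 ≤ V * T * r := by positivity
    linarith

end IsPSPIRun
end MDP
end SoftPolicy
-- Concentration of excess squared losses
section Concentration
variable {S A : Type*} [Fintype S] [Fintype A]

/-- Chernoff bound for an i.i.d. sum whose exponential moment is at most one. -/
lemma measureReal_sum_ge_le_exp_neg {Ω E : Type*} [MeasurableSpace Ω] [MeasurableSpace E]
    {Pr : Measure Ω} [IsProbabilityMeasure Pr] {n : ℕ} {D : Fin n → Ω → E}
    (hD : ∀ i, Measurable (D i)) (hind : iIndepFun D Pr) {ν : Measure E}
    (hlaw : ∀ i, Pr.map (D i) = ν) {Z : E → ℝ} (hZ : Measurable Z)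
    (hint : Integrable (fun e => Real.exp (Z e)) ν) (hexp : ∫ e, Real.exp (Z e) ∂ν ≤ 1) (c : ℝ) :
    Pr.real {ω | c ≤ ∑ i, Z (D i ω)} ≤ Real.exp (-c) := by
  have hind' : iIndepFun (fun i ω => Z (D i ω)) Pr := hind.comp (fun _ => Z) fun _ => hZ
  have hm : ∀ i, Measurable fun ω => Z (D i ω) := fun i => hZ.comp (hD i)
  have hi : ∀ i, Integrable (fun ω => Real.exp (1 * Z (D i ω))) Pr := fun i => by
    simp only [one_mul]
    rw [← hlaw i] at hint
    exact hint.comp_measurable (hD i)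
  have hs : (∑ i, fun ω => Z (D i ω)) = fun ω => ∑ i, Z (D i ω) := by
    ext ω
    simp
  have h1 := hind'.integrable_exp_mul_sum hm (s := Finset.univ) fun i _ => hi i
  have h2 := hind'.mgf_sum (t := 1) hm Finset.univ
  rw [hs] at h1 h2
  refine (measure_ge_le_exp_mul_mgf c zero_le_one h1).trans ?_
  rw [neg_one_mul, h2]
  refine mul_le_of_le_one_right (Real.exp_pos _).le
    (Finset.prod_le_one (fun _ _ => mgf_nonneg) fun i _ => ?_)
  unfold mgf
  simp only [one_mul]
  rw [← integral_map (hD i).aemeasurable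
    (f := fun e => Real.exp (Z e)) (by fun_prop), hlaw i]
  exact hexp

namespace MDP
variable (M : MDP S A)

/-- The regression target `r + γ f(s', π)` of a data tuple. -/
noncomputable def target (f : S × A → ℝ) (π : Policy S A) (e : S × A × ℝ × S) : ℝ :=
  e.2.2.1 + M.γ * evalAt f e.2.2.2 π

/-- The excess squared loss of `f'` over the Bellman backup of `f` on one data tuple. -/
noncomputable def excessLoss (f' f : S × A → ℝ) (π : Policy S A) (e : S × A × ℝ × S) : ℝ :=
  (f' (e.1, e.2.1) - M.target f π e) ^ 2 - (M.bellman π f (e.1, e.2.1) - M.target f π e) ^ 2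

lemma target_mem_Icc {f : S × A → ℝ} (hf : ∀ x, 0 ≤ f x ∧ f x ≤ M.Vmax) (π : Policy S A)
    (x : S × A) (s' : S) : 0 ≤ M.target f π (x.1, x.2, M.R x.1 x.2, s') ∧
      M.target f π (x.1, x.2, M.R x.1 x.2, s') ≤ M.Vmax := by
  have h := evalAt_mem_Icc hf s' π
  have := M.Vmax_mul
  have h1 := M.R_nonneg x.1 x.2
  have h2 := M.R_le x.1 x.2
  have h3 := mul_nonneg M.γ_nonneg h.1
  have h4 := mul_le_mul_of_nonneg_left h.2 M.γ_nonneg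
  unfold target
  constructor <;> dsimp only <;> nlinarith

variable [MeasurableSpace S] [MeasurableSingletonClass S]
  [MeasurableSpace A] [MeasurableSingletonClass A]

lemma measurable_excessLoss (f' f : S × A → ℝ) (π : Policy S A) :
    Measurable (M.excessLoss f' f π) := by
  have h1 : ∀ g : S × A → ℝ, Measurable fun e : S × A × ℝ × S => g (e.1, e.2.1) := fun g =>
    (measurable_of_countable g).comp (by fun_prop)
  have h2 : Measurable (M.target f π) :=
    (by fun_prop : Measurable fun e : S × A × ℝ × S => e.2.2.1).add
      (((measurable_of_countable fun s => evalAt f s π).comp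
        (by fun_prop : Measurable fun e : S × A × ℝ × S => e.2.2.2)).const_mul _)
  exact (((h1 f').sub h2).pow_const 2).sub (((h1 _).sub h2).pow_const 2)

lemma integrable_dataLaw (μ : stdSimplex ℝ (S × A)) (g : S × A × ℝ × S → ℝ) :
    Integrable g (M.dataLaw μ) := by
  unfold dataLaw
  refine integrable_finsetSum_measure.2 fun x _ =>
    integrable_finsetSum_measure.2 fun s' _ => ?_
  exact (integrable_dirac (by simp)).smul_measure ENNReal.ofReal_ne_top

lemma integral_dataLaw (μ : stdSimplex ℝ (S × A)) (g : S × A × ℝ × S → ℝ) :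
    ∫ e, g e ∂M.dataLaw μ =
      ∑ x, μ.1 x * ∑ s', (M.P x.1 x.2).1 s' * g (x.1, x.2, M.R x.1 x.2, s') := by
  have h : ∀ x : S × A, ∀ s', Integrable g (ENNReal.ofReal (μ.1 x * (M.P x.1 x.2).1 s') •
      Measure.dirac (x.1, x.2, M.R x.1 x.2, s')) := fun x s' =>
    (integrable_dirac (by simp)).smul_measure ENNReal.ofReal_ne_top
  unfold dataLaw
  rw [integral_finsetSum_measure fun x _ => integrable_finsetSum_measure.2 fun s' _ => h x s']
  refine Finset.sum_congr rfl fun x _ => ?_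
  rw [integral_finsetSum_measure fun s' _ => h x s', Finset.mul_sum]
  refine Finset.sum_congr rfl fun s' _ => ?_
  rw [integral_smul_measure, integral_dirac, ENNReal.toReal_ofReal
    (mul_nonneg (simplex_nonneg _ _) (simplex_nonneg _ _)), smul_eq_mul, mul_assoc]

lemma integral_dataLaw_mono (μ : stdSimplex ℝ (S × A)) {g h : S × A × ℝ × S → ℝ}
    (hgh : ∀ (x : S × A) s', g (x.1, x.2, M.R x.1 x.2, s') ≤ h (x.1, x.2, M.R x.1 x.2, s')) :
    ∫ e, g e ∂M.dataLaw μ ≤ ∫ e, h e ∂M.dataLaw μ := by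
  rw [integral_dataLaw, integral_dataLaw]
  exact Finset.sum_le_sum fun x _ => mul_le_mul_of_nonneg_left
    (Finset.sum_le_sum fun s' _ => mul_le_mul_of_nonneg_left (hgh x s') (simplex_nonneg _ _))
    (simplex_nonneg _ _)

/-- Given `(s, a)`, the regression target has mean `T^π f`, so the cross term of the square
vanishes. -/
lemma integral_excessLoss (μ : stdSimplex ℝ (S × A)) (f' f : S × A → ℝ) (π : Policy S A) :
    ∫ e, M.excessLoss f' f π e ∂M.dataLaw μ =
      normSq μ.1 fun x => f' x - M.bellman π f x := by
  rw [integral_dataLaw]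
  refine Finset.sum_congr rfl fun x _ => ?_
  congr 1
  have h1 := simplex_sum (M.P x.1 x.2)
  set P := (M.P x.1 x.2).1
  have h2 : ∀ s', P s' * M.excessLoss f' f π (x.1, x.2, M.R x.1 x.2, s') =
      (f' x ^ 2 - M.bellman π f x ^ 2 - 2 * (f' x - M.bellman π f x) * M.R x.1 x.2) * P s' -
        2 * (f' x - M.bellman π f x) * M.γ * (P s' * evalAt f s' π) := fun s' => by
    simp only [excessLoss, target]
    ring
  simp only [h2, Finset.sum_sub_distrib, ← Finset.mul_sum, h1]
  have h3 : M.γ * ∑ s', P s' * evalAt f s' π = M.bellman π f x - M.R x.1 x.2 := by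
    unfold bellman
    ring
  rw [mul_assoc _ M.γ, h3]
  ring

/-- As a difference of squares, the excess loss is `f' - T^π f` times a factor bounded by `2 V_max`.
This ties its second moment to its mean, the source of the fast rate. -/
lemma excessLoss_sq_le {f' f : S × A → ℝ} (hf' : ∀ x, 0 ≤ f' x ∧ f' x ≤ M.Vmax)
    (hf : ∀ x, 0 ≤ f x ∧ f x ≤ M.Vmax) (π : Policy S A) (x : S × A) (s' : S) :
    M.excessLoss f' f π (x.1, x.2, M.R x.1 x.2, s') ^ 2 ≤
        4 * M.Vmax ^ 2 * (f' x - M.bellman π f x) ^ 2 ∧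
      |M.excessLoss f' f π (x.1, x.2, M.R x.1 x.2, s')| ≤ 2 * M.Vmax ^ 2 := by
  obtain ⟨a1, a2⟩ := hf' x
  obtain ⟨b1, b2⟩ := M.bellman_mem_Icc hf π x
  obtain ⟨c1, c2⟩ := M.target_mem_Icc hf π x s'
  have e : M.excessLoss f' f π (x.1, x.2, M.R x.1 x.2, s') = (f' x - M.bellman π f x) *
      (f' x + M.bellman π f x - 2 * M.target f π (x.1, x.2, M.R x.1 x.2, s')) := by
    simp only [excessLoss]
    ring
  rw [e]
  set u := f' x - M.bellman π f x with hu
  set v := f' x + M.bellman π f x - 2 * M.target f π (x.1, x.2, M.R x.1 x.2, s') with hv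
  have h1 : |u| ≤ M.Vmax := abs_le.2 ⟨by linarith, by linarith⟩
  have h2 : |v| ≤ 2 * M.Vmax := abs_le.2 ⟨by linarith, by linarith⟩
  constructor
  · have := sq_le_sq' (abs_le.1 h2).1 (abs_le.1 h2).2
    nlinarith [sq_nonneg u]
  · rw [abs_mul]
    calc |u| * |v| ≤ M.Vmax * (2 * M.Vmax) := mul_le_mul h1 h2 (abs_nonneg _) (by linarith)
      _ = _ := by ring

lemma integral_exp_excessLoss_le (μ : stdSimplex ℝ (S × A)) (hV : 0 < M.Vmax)
    {f' f : S × A → ℝ} (hf' : ∀ x, 0 ≤ f' x ∧ f' x ≤ M.Vmax)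
    (hf : ∀ x, 0 ≤ f x ∧ f x ≤ M.Vmax) (π : Policy S A) {θ : ℝ}
    (hθ : |θ| = 1 / (8 * M.Vmax ^ 2)) :
    ∫ e, Real.exp (θ * M.excessLoss f' f π e) ∂M.dataLaw μ ≤
      Real.exp ((θ + |θ| / 2) * normSq μ.1 fun x => f' x - M.bellman π f x) := by
  set m := normSq μ.1 fun x => f' x - M.bellman π f x with hm
  have hV2 : |θ| * M.Vmax ^ 2 = 1 / 8 := by
    rw [hθ]
    field_simp
  have h1 : ∫ e, Real.exp (θ * M.excessLoss f' f π e) ∂M.dataLaw μ ≤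
      ∫ e, (1 + θ * M.excessLoss f' f π e +
        |θ| / 2 * (f' (e.1, e.2.1) - M.bellman π f (e.1, e.2.1)) ^ 2) ∂M.dataLaw μ := by
    refine M.integral_dataLaw_mono μ fun x s' => ?_
    obtain ⟨h1, h2⟩ := M.excessLoss_sq_le hf' hf π x s'
    set X := M.excessLoss f' f π (x.1, x.2, M.R x.1 x.2, s')
    have h3 : |θ * X| ≤ 1 := by
      rw [abs_mul]
      nlinarith [abs_nonneg θ]
    have h4 := exp_le_one_add_add_sq h3
    -- The size of `θ` makes the quadratic term at most half of the linear one: `4 V_max² θ² = |θ| /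
    -- 2`. The factors `3/2` and `1/2` of the uniform bound come from here, for positive and
    -- negative `θ`.
    have h5 : (θ * X) ^ 2 ≤ |θ| / 2 * (f' x - M.bellman π f x) ^ 2 := by
      rw [mul_pow, ← sq_abs θ]
      calc |θ| ^ 2 * X ^ 2 ≤ |θ| ^ 2 * (4 * M.Vmax ^ 2 * (f' x - M.bellman π f x) ^ 2) :=
            mul_le_mul_of_nonneg_left h1 (sq_nonneg _)
        _ = 4 * |θ| * (|θ| * M.Vmax ^ 2) * (f' x - M.bellman π f x) ^ 2 := by ring
        _ = _ := by rw [hV2]; ring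
    change _ ≤ 1 + θ * X + |θ| / 2 * (f' x - M.bellman π f x) ^ 2
    linarith
  have h2 : ∫ e, (1 + θ * M.excessLoss f' f π e +
      |θ| / 2 * (f' (e.1, e.2.1) - M.bellman π f (e.1, e.2.1)) ^ 2) ∂M.dataLaw μ =
      1 + (θ + |θ| / 2) * m := by
    rw [integral_add (M.integrable_dataLaw μ _) (M.integrable_dataLaw μ _),
      integral_add (M.integrable_dataLaw μ _) (M.integrable_dataLaw μ _),
      integral_const_mul, integral_const_mul, integral_excessLoss]
    have e1 : ∫ _e, (1 : ℝ) ∂M.dataLaw μ = 1 := by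
      rw [integral_dataLaw]
      simp only [mul_one, simplex_sum]
    have e2 : ∫ e, (f' (e.1, e.2.1) - M.bellman π f (e.1, e.2.1)) ^ 2 ∂M.dataLaw μ = m := by
      rw [integral_dataLaw]
      simp only [← Finset.sum_mul, simplex_sum, one_mul]
      rfl
    rw [e1, e2]
    ring
  have h3 := Real.add_one_le_exp ((θ + |θ| / 2) * m)
  linarith

variable {Ω : Type*} [MeasurableSpace Ω] {Pr : Measure Ω} [IsProbabilityMeasure Pr]
  {n : ℕ} {D : Fin n → Ω → S × A × ℝ × S}

lemma measureReal_excessLoss_deviation_le (μ : stdSimplex ℝ (S × A)) (hV : 0 < M.Vmax)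
    (hD : ∀ i, Measurable (D i)) (hind : iIndepFun D Pr)
    (hlaw : ∀ i, Pr.map (D i) = M.dataLaw μ)
    {f' f : S × A → ℝ} (hf' : ∀ x, 0 ≤ f' x ∧ f' x ≤ M.Vmax)
    (hf : ∀ x, 0 ≤ f x ∧ f x ≤ M.Vmax) (π : Policy S A) {θ : ℝ}
    (hθ : |θ| = 1 / (8 * M.Vmax ^ 2)) (c : ℝ) :
    Pr.real {ω | c ≤ ∑ i, (θ * M.excessLoss f' f π (D i ω) -
      (θ + |θ| / 2) * normSq μ.1 fun x => f' x - M.bellman π f x)} ≤ Real.exp (-c) := by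
  refine measureReal_sum_ge_le_exp_neg hD hind hlaw (Z := fun e =>
    θ * M.excessLoss f' f π e - (θ + |θ| / 2) * normSq μ.1 fun x => f' x - M.bellman π f x)
    (((M.measurable_excessLoss f' f π).const_mul _).sub_const _) (M.integrable_dataLaw μ _) ?_ c
  simp only [Real.exp_sub]
  rw [integral_div, div_le_one (Real.exp_pos _)]
  exact M.integral_exp_excessLoss_le μ hV hf' hf π hθ

/-- Uniform concentration of the excess losses over a finite function class and a finite set of
policies. -/
lemma exists_uniform_concentration (μ : stdSimplex ℝ (S × A)) (hV : 0 < M.Vmax) (hn : 0 < n)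
    (hD : ∀ i, Measurable (D i)) (hind : iIndepFun D Pr)
    (hlaw : ∀ i, Pr.map (D i) = M.dataLaw μ) {F : Finset (S × A → ℝ)} (hF : F.Nonempty)
    (hFr : ∀ f ∈ F, ∀ x, 0 ≤ f x ∧ f x ≤ M.Vmax) {Pol : Set (Policy S A)} (hPol : Pol.Finite)
    (hPol' : Pol.Nonempty) {δ : ℝ} (hδ : 0 < δ) :
    ∃ G : Set Ω, MeasurableSet G ∧ 1 - δ ≤ Pr.real G ∧ ∀ ω ∈ G, ∀ f' ∈ F, ∀ f ∈ F, ∀ π ∈ Pol,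
      (1 / 2) * normSq μ.1 (fun x => f' x - M.bellman π f x) -
          8 * M.Vmax ^ 2 * Real.log (2 * F.card ^ 2 * Pol.ncard / δ) / n ≤
        (1 / n) * ∑ i, M.excessLoss f' f π (D i ω) ∧
      (1 / n) * ∑ i, M.excessLoss f' f π (D i ω) ≤
        (3 / 2) * normSq μ.1 (fun x => f' x - M.bellman π f x) +
          8 * M.Vmax ^ 2 * Real.log (2 * F.card ^ 2 * Pol.ncard / δ) / n := by
  classical
  -- Number of events in the union bound: two signs of `θ` for each triple `(f', f, π)`.
  set N : ℝ := 2 * F.card ^ 2 * Pol.ncard with hN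
  have hNpos : 0 < N := by
    have h1 : (0 : ℝ) < F.card := Nat.cast_pos.2 hF.card_pos
    have h2 : (0 : ℝ) < Pol.ncard := Nat.cast_pos.2 ((Set.ncard_pos hPol).2 hPol')
    positivity
  set ℓ := Real.log (N / δ) with hℓ
  set θ : ℝ := 1 / (8 * M.Vmax ^ 2) with hθ
  have hθpos : 0 < θ := by positivity
  set bad : ((S × A → ℝ) × (S × A → ℝ) × Policy S A) → ℝ → Set Ω := fun u τ =>
    {ω | ℓ ≤ ∑ i, (τ * M.excessLoss u.1 u.2.1 u.2.2 (D i ω) -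
      (τ + |τ| / 2) * normSq μ.1 fun x => u.1 x - M.bellman u.2.2 u.2.1 x)} with hbad
  have hmeas : ∀ u τ, MeasurableSet (bad u τ) := fun u τ =>
    measurableSet_le measurable_const (Finset.measurable_fun_sum _ fun i _ =>
      (((M.measurable_excessLoss _ _ _).comp (hD i)).const_mul _).sub_const _)
  set I := F ×ˢ F ×ˢ hPol.toFinset with hI
  set B : Set Ω := ⋃ u ∈ I, (bad u θ ∪ bad u (-θ)) with hB
  have hBm : MeasurableSet B :=
    Finset.measurableSet_biUnion _ fun u _ => (hmeas u θ).union (hmeas u (-θ))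
  have hexp : Real.exp (-ℓ) = δ / N := by
    rw [Real.exp_neg, Real.exp_log (div_pos hNpos hδ), inv_div]
  have hBle : Pr.real B ≤ δ := by
    refine (measureReal_biUnion_finset_le _ _).trans ?_
    calc _ ≤ ∑ _u ∈ I, 2 * (δ / N) := by
          refine Finset.sum_le_sum fun u hu => ?_
          simp only [hI, Finset.mem_product, Set.Finite.mem_toFinset] at hu
          have h1 := M.measureReal_excessLoss_deviation_le μ hV hD hind hlaw (hFr _ hu.1)
            (hFr _ hu.2.1) u.2.2 (θ := θ) (abs_of_pos hθpos) ℓ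
          have h2 := M.measureReal_excessLoss_deviation_le μ hV hD hind hlaw (hFr _ hu.1)
            (hFr _ hu.2.1) u.2.2 (θ := -θ) (by rw [abs_neg]; exact abs_of_pos hθpos) ℓ
          rw [hexp] at h1 h2
          refine (measureReal_union_le _ _).trans ?_
          rw [two_mul]
          exact add_le_add h1 h2
      _ = δ := by
          rw [Finset.sum_const, nsmul_eq_mul, hI, Finset.card_product, Finset.card_product,
            ← Set.ncard_eq_toFinset_card Pol hPol]
          push_cast
          have : (F.card * (F.card * Pol.ncard) : ℝ) * (2 * (δ / N)) = N * (δ / N) := by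
            rw [hN]
            ring
          rw [this, mul_div_cancel₀ _ hNpos.ne']
  refine ⟨Bᶜ, hBm.compl, ?_, fun ω hω f' hf' f hf π hπ => ?_⟩
  · rw [probReal_compl_eq_one_sub hBm]
    linarith
  · have hu : (f', f, π) ∈ I := by
      simp only [hI, Finset.mem_product, Set.Finite.mem_toFinset]
      exact ⟨hf', hf, hπ⟩
    simp only [hB, Set.mem_compl_iff, Set.mem_iUnion, not_exists, Set.mem_union, not_or] at hω
    obtain ⟨h1, h2⟩ := hω _ hu
    simp only [hbad, Set.mem_ofPred_eq, not_le, Finset.sum_sub_distrib, ← Finset.mul_sum,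
      Finset.sum_const, Finset.card_univ, Fintype.card_fin, nsmul_eq_mul, abs_neg,
      abs_of_pos hθpos] at h1 h2
    set X := ∑ i, M.excessLoss f' f π (D i ω)
    set m := normSq μ.1 fun x => f' x - M.bellman π f x
    have hn' : (0 : ℝ) < n := Nat.cast_pos.2 hn
    -- Dividing the exponential-moment inequalities by `n θ` turns the level `ℓ` into the deviation
    -- `8 V_max² ℓ / n`.
    have hVθ : 8 * M.Vmax ^ 2 * ℓ / n = ℓ / (n * θ) := by
      rw [hθ]
      field_simp
    rw [hVθ]
    have e : ℓ / (n * θ) * (n * θ) = ℓ := div_mul_cancel₀ _ (by positivity)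
    have e2 : 1 / (n : ℝ) * X * (n * θ) = θ * X := by field_simp
    have hp : 0 < n * θ := by positivity
    constructor
    · refine le_of_mul_le_mul_right ?_ hp
      rw [e2, sub_mul, e]
      linarith
    · refine le_of_mul_le_mul_right ?_ hp
      rw [e2, add_mul, e]
      linarith

end MDP
end Concentration
-- From concentration to suboptimality of the mixture
section Pessimism
variable {S A : Type*} [Fintype S] [Fintype A]

namespace MDP
variable {M : MDP S A} {μ : stdSimplex ℝ (S × A)} {F : Finset (S × A → ℝ)}
  {Pol : Set (Policy S A)}

lemma Realizability.exists_mem {ε : ℝ} (h : M.Realizability μ F Pol ε) (hF : F.Nonempty)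
    (hPol : Pol.Finite) {π : Policy S A} (hπ : π ∈ Pol) :
    ∃ f ∈ F, normSq μ.1 (M.bellmanError π f) ≤ ε ∧
      normSq (M.occupancy π) (M.bellmanError π f) ≤ ε := by
  have : Nonempty {f // f ∈ F} := hF.to_subtype
  -- Finiteness makes the real-valued supremum bounded, so that it dominates each member, and
  -- finiteness of `F` makes the infimum attained.
  have : Finite (M.admissible μ Pol) := ((hPol.image M.occupancy).insert μ.1).to_subtype
  obtain ⟨f, hf⟩ := exists_eq_ciInf_of_finite
    (f := fun f : {f // f ∈ F} => ⨆ ν : M.admissible μ Pol, normSq ν.1 (M.bellmanError π f.1))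
  have hle : (⨆ ν : M.admissible μ Pol, normSq ν.1 (M.bellmanError π f.1)) ≤ ε :=
    hf.le.trans (h π hπ)
  have hb : ∀ ν : M.admissible μ Pol, normSq ν.1 (M.bellmanError π f.1) ≤ ε := fun ν =>
    (le_ciSup (f := fun ν : M.admissible μ Pol => normSq ν.1 (M.bellmanError π f.1))
      (Set.finite_range _).bddAbove ν).trans hle
  exact ⟨f.1, f.2, hb ⟨μ.1, Set.mem_insert _ _⟩,
    hb ⟨M.occupancy π, Set.mem_insert_of_mem _ ⟨π, hπ, rfl⟩⟩⟩

lemma Completeness.exists_mem {ε : ℝ} (h : M.Completeness μ F Pol ε) (hF : F.Nonempty)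
    {π : Policy S A} (hπ : π ∈ Pol) {f : S × A → ℝ} (hf : f ∈ F) :
    ∃ f' ∈ F, normSq μ.1 (fun x => f' x - M.bellman π f x) ≤ ε := by
  have : Nonempty {f // f ∈ F} := hF.to_subtype
  obtain ⟨f', hf'⟩ := exists_eq_ciInf_of_finite
    (f := fun f' : {f' // f' ∈ F} => normSq μ.1 (fun x => f'.1 x - M.bellman π f x))
  refine ⟨f'.1, f'.2, hf'.le.trans (le_trans ?_ (h π hπ))⟩
  exact le_ciSup (f := fun f : {f // f ∈ F} => ⨅ f' : {f' // f' ∈ F},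
    normSq μ.1 (fun x => f'.1 x - M.bellman π f.1 x)) (Set.finite_range _).bddAbove ⟨f, hf⟩

/-- The second summand does not depend on `f'`. It cancels in `E(f, π; D)`, so only excess losses
matter. -/
lemma empLoss_eq {n : ℕ} (D : Fin n → S × A × ℝ × S) (f' f : S × A → ℝ) (π : Policy S A) :
    M.empLoss D f' f π = (1 / n) * ∑ i, M.excessLoss f' f π (D i) +
      (1 / n) * ∑ i, (M.bellman π f ((D i).1, (D i).2.1) - M.target f π (D i)) ^ 2 := by
  unfold empLoss excessLoss
  rw [← mul_add, ← Finset.sum_add_distrib]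
  congr 1
  refine Finset.sum_congr rfl fun i _ => ?_
  unfold target
  ring

lemma le_empBellmanError {n : ℕ} (D : Fin n → S × A × ℝ × S) (f : S × A → ℝ)
    (π : Policy S A) {f' : S × A → ℝ} (hf' : f' ∈ F) :
    M.empLoss D f f π - M.empLoss D f' f π ≤ M.empBellmanError F D f π :=
  sub_le_sub_left (ciInf_le (f := fun f' : {f' // f' ∈ F} => M.empLoss D f'.1 f π)
    (Set.finite_range _).bddBelow ⟨f', hf'⟩) _

lemma empBellmanError_nonneg {n : ℕ} (D : Fin n → S × A × ℝ × S) {f : S × A → ℝ}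
    (hf : f ∈ F) (π : Policy S A) : 0 ≤ M.empBellmanError F D f π := by
  simpa using le_empBellmanError D f π hf (M := M)

section Concentrated
variable {n : ℕ} {D : Fin n → S × A × ℝ × S} {π : Policy S A} {κ : ℝ}

lemma empBellmanError_le (hF : F.Nonempty)
    (hc : ∀ f' ∈ F, ∀ f ∈ F,
      (1 / 2) * normSq μ.1 (fun x => f' x - M.bellman π f x) - κ ≤
        (1 / n) * ∑ i, M.excessLoss f' f π (D i) ∧
      (1 / n) * ∑ i, M.excessLoss f' f π (D i) ≤
        (3 / 2) * normSq μ.1 (fun x => f' x - M.bellman π f x) + κ)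
    {f : S × A → ℝ} (hf : f ∈ F) :
    M.empBellmanError F D f π ≤ (3 / 2) * normSq μ.1 (M.bellmanError π f) + 2 * κ := by
  have : Nonempty {f // f ∈ F} := hF.to_subtype
  have h1 := (hc f hf f hf).2
  have h2 : M.empLoss D f f π - (3 / 2 * normSq μ.1 (M.bellmanError π f) + 2 * κ) ≤
      ⨅ f' : {f' // f' ∈ F}, M.empLoss D f'.1 f π := by
    refine le_ciInf fun f' => ?_
    have h3 := (hc f'.1 f'.2 f hf).1
    have h4 := normSq_nonneg (simplex_nonneg μ) fun x => f'.1 x - M.bellman π f x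
    rw [empLoss_eq, empLoss_eq]
    change _ ≤ 3 / 2 * normSq μ.1 (M.bellmanError π f) + κ at h1
    linarith
  unfold empBellmanError
  linarith

lemma normSq_bellmanError_le
    (hc : ∀ f' ∈ F, ∀ f ∈ F,
      (1 / 2) * normSq μ.1 (fun x => f' x - M.bellman π f x) - κ ≤
        (1 / n) * ∑ i, M.excessLoss f' f π (D i) ∧
      (1 / n) * ∑ i, M.excessLoss f' f π (D i) ≤
        (3 / 2) * normSq μ.1 (fun x => f' x - M.bellman π f x) + κ)
    {f f' : S × A → ℝ} (hf : f ∈ F) (hf' : f' ∈ F) :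
    normSq μ.1 (M.bellmanError π f) ≤ 2 * M.empBellmanError F D f π +
      3 * normSq μ.1 (fun x => f' x - M.bellman π f x) + 4 * κ := by
  have h1 := (hc f hf f hf).1
  have h2 := (hc f' hf' f hf).2
  have h3 := le_empBellmanError D f π hf' (M := M)
  rw [empLoss_eq, empLoss_eq] at h3
  change 1 / 2 * normSq μ.1 (M.bellmanError π f) - κ ≤ _ at h1
  linarith

end Concentrated

lemma J_sub_mixtureJ_le_Vmax (M : MDP S A) (π : Policy S A) (T : ℕ) (πs : ℕ → Policy S A) :
    M.J π - M.mixtureJ T πs ≤ M.Vmax := by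
  have h : 0 ≤ M.mixtureJ T πs := by
    rw [mixtureJ_eq]
    exact mul_nonneg (by positivity) (Finset.sum_nonneg fun t _ => (M.J_mem_Icc _).1)
  linarith [(M.J_mem_Icc π).2]

/-- Suboptimality of the mixture from per-round bounds on the overestimation and on the Bellman
error. The first round, whose policy is uniform, needs no such bounds. -/
lemma IsPSPIRun.J_sub_mixtureJ_le [Nonempty A] {lam eta : ℝ} {T n : ℕ}
    {D : Fin n → S × A × ℝ × S} {f : ℕ → S × A → ℝ} {πs : ℕ → Policy S A}
    (h : M.IsPSPIRun F lam eta T D f πs) (hV : 0 < M.Vmax) (hT : 0 < T)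
    (hA : 2 ≤ Fintype.card A) (hF : ∀ f ∈ F, ∀ x, 0 ≤ f x ∧ f x ≤ M.Vmax)
    (heta : eta = √(Real.log (Fintype.card A) / (2 * M.Vmax ^ 2 * T)))
    (π : Policy S A) {C₂ : ℝ} (hC : 1 ≤ C₂) {a b : ℝ} (ha : 0 ≤ a)
    (hround : ∀ t, 0 < t → t < T → evalAt (f t) M.s₀ (πs t) - M.J (πs t) ≤ a ∧
      normSq μ.1 (M.bellmanError (πs t) (f t)) ≤ b) :
    M.J π - M.mixtureJ T πs ≤ a + √(C₂ * b) / (1 - M.γ) +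
      7 * (M.Vmax / (1 - M.γ) * √(Real.log (Fintype.card A) / T)) +
      (1 / (T : ℝ)) * ∑ t ∈ Finset.range T, M.offSupport μ F C₂ π (πs t) (f t) := by
  have hg := M.one_sub_γ_pos
  have hT' : (0 : ℝ) < T := Nat.cast_pos.2 hT
  have hlog : Real.log 2 ≤ Real.log (Fintype.card A) :=
    Real.log_le_log (by norm_num) (by exact_mod_cast hA)
  have hlog2 := Real.log_two_gt_d9
  set r := √(Real.log (Fintype.card A) / T) with hr
  set gap : ℕ → ℝ := fun t =>
    (∑ x, M.occupancy π x * (evalAt (f t) x.1 π - evalAt (f t) x.1 (πs t))) / (1 - M.γ)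
  have hgap_sum : ∑ t ∈ Finset.range T, gap t ≤ 3 * (M.Vmax * T * r) / (1 - M.γ) := by
    rw [← Finset.sum_div]
    refine div_le_div_of_nonneg_right ?_ hg.le
    rw [Finset.sum_comm]
    simp only [← Finset.mul_sum]
    exact (weighted_sum_mem_Icc (a := ∑ t ∈ Finset.range T, -M.Vmax)
      (M.occupancy_nonneg π) (M.sum_occupancy π) fun x =>
        ⟨Finset.sum_le_sum fun t ht => by
          have hb := hF _ (h.mem t (Finset.mem_range.1 ht))
          have h1 := (evalAt_mem_Icc hb x.1 π).1
          have h2 := (evalAt_mem_Icc hb x.1 (πs t)).2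
          linarith,
        h.regret hV hT (by linarith) hF heta x.1 π⟩).2
  have hgap_zero : -(M.Vmax / (1 - M.γ)) ≤ gap 0 := by
    rw [← neg_div]
    refine div_le_div_of_nonneg_right ?_ hg.le
    have hb := hF _ (h.mem 0 hT)
    exact (weighted_sum_mem_Icc (b := M.Vmax)
      (M.occupancy_nonneg π) (M.sum_occupancy π) fun x => by
        obtain ⟨h1, h2⟩ := evalAt_mem_Icc hb x.1 π
        obtain ⟨h3, h4⟩ := evalAt_mem_Icc hb x.1 (πs 0)
        constructor <;> linarith).1
  -- Round `0` uses only trivial bounds. `J π - J (πs 0)` and `-gap 0` are each at most `V_max / (1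
  -- - γ)`, whence the correction term.
  have hstep : ∀ t ∈ Finset.range T, M.J π - M.J (πs t) ≤
      (a + √(C₂ * b) / (1 - M.γ)) + M.offSupport μ F C₂ π (πs t) (f t) + gap t +
        (if t = 0 then 2 * (M.Vmax / (1 - M.γ)) else 0) := by
    intro t ht
    have ht' := Finset.mem_range.1 ht
    rcases Nat.eq_zero_or_pos t with rfl | h0
    · have h1 := (M.J_mem_Icc π).2
      have h2 := (M.J_mem_Icc (πs 0)).1
      have h3 : M.Vmax ≤ M.Vmax / (1 - M.γ) :=
        le_div_self hV.le hg (by linarith [M.γ_nonneg])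
      have h4 := M.offSupport_nonneg μ F C₂ π (πs 0) (f 0)
      have h5 : 0 ≤ √(C₂ * b) / (1 - M.γ) := div_nonneg (Real.sqrt_nonneg _) hg.le
      rw [if_pos rfl]
      linarith
    · obtain ⟨h1, h2⟩ := hround t h0 ht'
      have h3 := M.J_sub_evalAt π (πs t) (f t)
      have h4 := M.neg_sum_occupancy_bellmanError_le (μ := μ) hC π (πs t) (h.mem t ht')
      have h5 : √(C₂ * normSq μ.1 (M.bellmanError (πs t) (f t))) / (1 - M.γ) ≤
          √(C₂ * b) / (1 - M.γ) :=
        div_le_div_of_nonneg_right (Real.sqrt_le_sqrt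
          (mul_le_mul_of_nonneg_left h2 (by linarith))) hg.le
      rw [if_neg h0.ne']
      change M.J π - evalAt (f t) M.s₀ (πs t) = _ + gap t at h3
      linarith
  have hsum := Finset.sum_le_sum hstep
  simp only [Finset.sum_add_distrib, Finset.sum_sub_distrib, Finset.sum_const, Finset.card_range,
    nsmul_eq_mul, Finset.sum_ite_eq', Finset.mem_range, hT, if_true] at hsum
  -- Since `log |A| ≥ log 2 ≥ 1/4`, the correction `2 V_max / (1 - γ)` is at most `4 T r V_max / (1
  -- - γ)`. With the regret constant `3` this makes `7`.
  have hr1 : 1 ≤ 2 * r * T := by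
    have h1 : 1 / (2 * (T : ℝ)) ≤ r := by
      refine Real.le_sqrt_of_sq_le ?_
      have hT1 : (1 : ℝ) ≤ T := by exact_mod_cast hT
      rw [div_pow, div_le_div_iff₀ (by positivity) hT']
      have h2 : (T : ℝ) * 1 ≤ T * T := mul_le_mul_of_nonneg_left hT1 hT'.le
      nlinarith
    rw [div_le_iff₀ (by positivity)] at h1
    linarith
  have hW : 0 ≤ M.Vmax / (1 - M.γ) := div_nonneg hV.le hg.le
  set off := ∑ t ∈ Finset.range T, M.offSupport μ F C₂ π (πs t) (f t)
  have hmain : (T : ℝ) * (M.J π - M.mixtureJ T πs) ≤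
      T * (a + √(C₂ * b) / (1 - M.γ) + 7 * (M.Vmax / (1 - M.γ) * r) + 1 / T * off) := by
    have e1 : (T : ℝ) * M.mixtureJ T πs = ∑ t ∈ Finset.range T, M.J (πs t) := by
      rw [mixtureJ_eq]
      field_simp
    have e2 : (T : ℝ) * (1 / T * off) = off := by field_simp
    have e3 : 3 * (M.Vmax * T * r) / (1 - M.γ) = 3 * (T * (M.Vmax / (1 - M.γ) * r)) := by ring
    have h4 := mul_le_mul_of_nonneg_left hr1 hW
    simp only [mul_add, mul_sub, e1, e2]
    linarith
  exact le_of_mul_le_mul_left hmain hT'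

end MDP

/-- The union-bound exponents in terms of `log (|F| / δ)`. -/
lemma log_card_bounds {cF cP T : ℕ} {δ : ℝ} (hδ : 0 < δ) (hδ' : δ < 1) (hF : 2 ≤ cF)
    (hP : 0 < cP) (hT : 0 < T) (hPle : cP ≤ T * cF ^ T) :
    Real.log (2 * cF ^ 2 * cP / δ) ≤ 3 * Real.log ((cF : ℝ) * cP / δ) ∧
      0 < Real.log ((cF : ℝ) * cP / δ) ∧
      Real.log ((cF : ℝ) * cP / δ) ≤ 3 * (T * Real.log (cF / δ)) := by
  have hF0 : (0 : ℝ) < cF := by exact_mod_cast (by omega : 0 < cF)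
  have hP0 : (0 : ℝ) < cP := by exact_mod_cast hP
  have hT1 : (1 : ℝ) ≤ T := by exact_mod_cast hT
  have h2 : Real.log 2 ≤ Real.log cF := Real.log_le_log (by norm_num) (by exact_mod_cast hF)
  have h20 : 0 < Real.log 2 := Real.log_pos (by norm_num)
  have hPl : 0 ≤ Real.log cP := Real.log_natCast_nonneg _
  have hd : Real.log δ < 0 := Real.log_neg hδ hδ'
  -- `T ≤ 2^T ≤ |F|^T` absorbs the factor `T` of the class size; this needs `|F| ≥ 2`.
  have hPu : Real.log cP ≤ 2 * T * Real.log cF := by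
    have h1 : cP ≤ cF ^ (2 * T) := by
      refine hPle.trans ?_
      rw [two_mul, pow_add]
      exact Nat.mul_le_mul_right _ (Nat.lt_two_pow_self.le.trans (Nat.pow_le_pow_left hF T))
    have h3 : Real.log cP ≤ Real.log ((cF : ℝ) ^ (2 * T)) :=
      Real.log_le_log hP0 (by exact_mod_cast h1)
    rw [Real.log_pow] at h3
    push_cast at h3
    exact h3
  rw [Real.log_div (by positivity) hδ.ne', Real.log_div (by positivity) hδ.ne',
    Real.log_div hF0.ne' hδ.ne', Real.log_mul (by positivity) hP0.ne',
    Real.log_mul (by positivity) (by positivity), Real.log_mul hF0.ne' hP0.ne', Real.log_pow]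
  push_cast
  refine ⟨by linarith, by linarith, ?_⟩
  nlinarith

lemma cube_rpow_one_third {x : ℝ} (hx : 0 ≤ x) : (x ^ (1 / 3 : ℝ)) ^ 3 = x := by
  rw [← Real.rpow_natCast, ← Real.rpow_mul hx]
  norm_num

lemma sqrt_mul_add_le {w e : ℝ} (hw : 0 ≤ w) (he : 0 ≤ e) :
    √(5 * w + 3 * e) ≤ 3 * √w + 2 * √e := by
  refine Real.sqrt_le_iff.2 ⟨by positivity, ?_⟩
  nlinarith [Real.sq_sqrt hw, Real.sq_sqrt he, mul_nonneg (Real.sqrt_nonneg w) (Real.sqrt_nonneg e)]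

end Pessimism
/-- The scale `λ ε_r` of the pessimism penalty: it balances the penalty against the admissible
Bellman error, and is bounded by the statistical and the approximation error. -/
lemma penalty_scale {V g ε lam Q : ℝ} {L εF n : ℝ} (hV : 0 < V) (hg : 0 < g) (hg1 : g ≤ 1)
    (hε : 0 < ε) (hn : 0 < n) (hQ : 0 ≤ Q) (hL : L ≤ 3 * Q) (hεF : 0 ≤ εF)
    (hεeq : ε = 139 * V ^ 2 * L / n + 39 * εF)
    (hlam : lam = (V / (g ^ 2 * ε ^ 2)) ^ (1 / 3 : ℝ)) :
    0 < lam ∧ √(V / lam) / g = lam * ε ∧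
      lam * ε ≤ 8 * (V / g * (Q / n) ^ (1 / 3 : ℝ) + (V * εF / g ^ 2) ^ (1 / 3 : ℝ)) := by
  have hpos : 0 < V / (g ^ 2 * ε ^ 2) := by positivity
  have hlpos : 0 < lam := hlam ▸ Real.rpow_pos_of_pos hpos _
  have h3 : lam ^ 3 = V / (g ^ 2 * ε ^ 2) := by
    rw [hlam]
    exact cube_rpow_one_third hpos.le
  -- Equivalently `V / lam = (lam ε g)²`, the balance for which `lam` is chosen.
  have h3' : lam ^ 3 * ε ^ 2 * g ^ 2 = V := by
    rw [h3]
    field_simp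
  refine ⟨hlpos, ?_, ?_⟩
  · have e : V / lam = (lam * ε * g) ^ 2 := by
      rw [div_eq_iff hlpos.ne', ← h3']
      ring
    rw [e, Real.sqrt_sq (by positivity), mul_div_cancel_right₀ _ hg.ne']
  · set y := (Q / n) ^ (1 / 3 : ℝ) with hy
    set z := (V * εF / g ^ 2) ^ (1 / 3 : ℝ) with hz
    have hy0 : 0 ≤ y := Real.rpow_nonneg (by positivity) _
    have hz0 : 0 ≤ z := Real.rpow_nonneg (by positivity) _
    have hy3 : y ^ 3 = Q / n := cube_rpow_one_third (by positivity)
    have hz3 : z ^ 3 = V * εF / g ^ 2 := cube_rpow_one_third (by positivity)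
    refine le_of_pow_le_pow_left₀ three_ne_zero (by positivity) ?_
    have e : (lam * ε) ^ 3 = V * ε / g ^ 2 := by
      rw [mul_pow, h3]
      field_simp
    have hQn : 0 ≤ V ^ 3 / g ^ 2 * (Q / n) := by positivity
    -- Here `417 = 139 * 3`. Both `417` and `39` are below `512 = 8³`, which gives the factor `8`.
    have h1 : V * ε / g ^ 2 ≤ 417 * (V ^ 3 / g ^ 2 * (Q / n)) + 39 * z ^ 3 := by
      rw [hz3, hεeq]
      have h2 : V ^ 3 / (g ^ 2 * n) * L ≤ V ^ 3 / (g ^ 2 * n) * (3 * Q) :=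
        mul_le_mul_of_nonneg_left hL (by positivity)
      have e1 : V * (139 * V ^ 2 * L / n + 39 * εF) / g ^ 2 =
          139 * (V ^ 3 / (g ^ 2 * n) * L) + 39 * (V * εF / g ^ 2) := by
        field_simp
      have e2 : V ^ 3 / g ^ 2 * (Q / n) = V ^ 3 / (g ^ 2 * n) * Q := by
        field_simp
      rw [e1, e2]
      linarith
    -- One factor `1 / g ≥ 1` is given away, since the cube of `V / g` carries `g³`.
    have h2 : V ^ 3 / g ^ 2 * (Q / n) ≤ (V / g * y) ^ 3 := by
      rw [mul_pow, hy3, div_pow]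
      refine mul_le_mul_of_nonneg_right ?_ (by positivity)
      exact div_le_div_of_nonneg_left (by positivity) (by positivity)
        (pow_le_pow_of_le_one hg.le hg1 (by norm_num))
    have hw0 : 0 ≤ V / g * y := by positivity
    set w := V / g * y
    rw [e]
    have h4 : w ^ 3 + z ^ 3 ≤ (w + z) ^ 3 := by
      have : (w + z) ^ 3 = w ^ 3 + z ^ 3 + 3 * (w * z * (w + z)) := by ring
      have : 0 ≤ w * z * (w + z) := by positivity
      linarith
    have h5 : (8 * (w + z)) ^ 3 = 512 * (w + z) ^ 3 := by ring
    have h6 : 0 ≤ w ^ 3 := by positivity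
    have h7 : 0 ≤ z ^ 3 := by positivity
    linarith

/-! ### Guarantees of one pessimistic round -/

namespace MDP
variable {S A : Type*} [Fintype S] [Fintype A] {M : MDP S A} {μ : stdSimplex ℝ (S × A)}
  {F : Finset (S × A → ℝ)}

/-- Per-round guarantees of a pessimistic value function on well concentrated data. -/
lemma IsPSPIRun.round_bounds {lam eta : ℝ} {T n : ℕ} {D : Fin n → S × A × ℝ × S}
    {f : ℕ → S × A → ℝ} {πs : ℕ → Policy S A} (h : M.IsPSPIRun F lam eta T D f πs)
    (hlam : 0 < lam) (hF : F.Nonempty) (hFr : ∀ f ∈ F, ∀ x, 0 ≤ f x ∧ f x ≤ M.Vmax)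
    {Pol : Set (Policy S A)} (hPol : Pol.Finite) {κ εF εFF εr : ℝ}
    (hκ : 3 / 2 * εF + 2 * κ ≤ εr) (hκ4 : 4 * κ ≤ εr) (hεr : lam * εr ≤ M.Vmax)
    (hreal : M.Realizability μ F Pol εF) (hcomp : M.Completeness μ F Pol εFF)
    {t : ℕ} (ht : t < T) (hmem : πs t ∈ Pol)
    (hc : ∀ f' ∈ F, ∀ f ∈ F,
      (1 / 2) * normSq μ.1 (fun x => f' x - M.bellman (πs t) f x) - κ ≤
        (1 / n) * ∑ i, M.excessLoss f' f (πs t) (D i) ∧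
      (1 / n) * ∑ i, M.excessLoss f' f (πs t) (D i) ≤
        (3 / 2) * normSq μ.1 (fun x => f' x - M.bellman (πs t) f x) + κ) :
    evalAt (f t) M.s₀ (πs t) - M.J (πs t) ≤ √εF / (1 - M.γ) + lam * εr ∧
      normSq μ.1 (M.bellmanError (πs t) (f t)) ≤ 5 * (M.Vmax / lam) + 3 * εFF := by
  obtain ⟨g, hg, hgμ, hgd⟩ := hreal.exists_mem hF hPol hmem
  obtain ⟨f', hf', hf'μ⟩ := hcomp.exists_mem hF hmem (h.mem t ht)
  have h1 := empBellmanError_le hF hc hg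
  have h2 := normSq_bellmanError_le hc (h.mem t ht) hf'
  have h3 := h.minimal t ht g hg
  have h4 := empBellmanError_nonneg D (h.mem t ht) (πs t) (M := M)
  have h5 := (evalAt_mem_Icc (hFr _ (h.mem t ht)) M.s₀ (πs t)).1
  have h6 := (evalAt_mem_Icc (hFr g hg) M.s₀ (πs t)).2
  have h7 := M.evalAt_sub_J_le (πs t) g
  have h8 : √(normSq (M.occupancy (πs t)) (M.bellmanError (πs t) g)) / (1 - M.γ) ≤
      √εF / (1 - M.γ) :=
    div_le_div_of_nonneg_right (Real.sqrt_le_sqrt hgd) M.one_sub_γ_pos.le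
  have h9 : M.empBellmanError F D g (πs t) ≤ εr := by linarith
  have h10 := mul_le_mul_of_nonneg_left h9 hlam.le
  have h11 := mul_nonneg hlam.le h4
  refine ⟨by linarith, ?_⟩
  -- The values at `s₀` differ by at most `V_max`, and `lam εr ≤ V_max`, so the penalty of `f t` is
  -- at most `2 V_max`.
  have h12 : M.empBellmanError F D (f t) (πs t) ≤ 2 * (M.Vmax / lam) := by
    rw [← mul_div_assoc, le_div_iff₀ hlam]
    linarith
  have h13 : εr ≤ M.Vmax / lam := by
    rw [le_div_iff₀ hlam]
    linarith
  linarith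

end MDP
end OfflineRL

/-! ### The theorem: degenerate cases and assembly -/

theorem theorem3 :
    ∃ C : ℝ, 0 < C ∧
      ∀ (S A Ω : Type*) [Fintype S] [Fintype A]
        [MeasurableSpace S] [MeasurableSingletonClass S]
        [MeasurableSpace A] [MeasurableSingletonClass A]
        [MeasurableSpace Ω] (Pr : Measure Ω) [IsProbabilityMeasure Pr]
        (M : OfflineRL.MDP S A) (μ : stdSimplex ℝ (S × A))
        (F : Finset (S × A → ℝ)) (_hF : F.Nonempty)
        (_hFrange : ∀ f ∈ F, ∀ x, 0 ≤ f x ∧ f x ≤ M.Vmax)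
        (n T : ℕ) (_hn : 0 < n) (_hT : 0 < T)
        (D : Fin n → Ω → S × A × ℝ × S) (_hDmeas : ∀ i, Measurable (D i))
        (_hDindep : iIndepFun D Pr) (_hDlaw : ∀ i, Pr.map (D i) = M.dataLaw μ)
        (δ εF εFF lam eta : ℝ) (_hδ : 0 < δ) (_hδ' : δ < 1)
        (_heta : eta = Real.sqrt (Real.log (Fintype.card A) / (2 * M.Vmax ^ 2 * T)))
        (_hlam : lam = (M.Vmax / ((1 - M.γ) ^ 2 *
          OfflineRL.epsR M.Vmax F.card (OfflineRL.spiClass F eta T).ncard n δ εF ^ 2)) ^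
            (1 / 3 : ℝ))
        (π : OfflineRL.Policy S A)
        (_hreal : M.Realizability μ F (OfflineRL.spiClass F eta T ∪ {π}) εF)
        (_hcomp : M.Completeness μ F (OfflineRL.spiClass F eta T ∪ {π}) εFF)
        (C₂ : ℝ) (_hC₂ : 1 ≤ C₂),
        ∃ G : Set Ω, MeasurableSet G ∧ 1 - δ ≤ Pr.real G ∧
          ∀ ω ∈ G, ∀ (f : ℕ → S × A → ℝ) (πs : ℕ → OfflineRL.Policy S A),
            M.IsPSPIRun F lam eta T (fun i => D i ω) f πs →
            M.J π - M.mixtureJ T πs ≤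
              C * (Real.sqrt C₂ *
                (Real.sqrt (εFF + εF) / (1 - M.γ)
                  + M.Vmax / (1 - M.γ) * (T * Real.log (F.card / δ) / n) ^ (1 / 3 : ℝ)
                  + (M.Vmax * εF / (1 - M.γ) ^ 2) ^ (1 / 3 : ℝ)))
              + C * (M.Vmax / (1 - M.γ) * Real.sqrt (Real.log (Fintype.card A) / T))
              + (1 / (T : ℝ)) * ∑ t ∈ Finset.range T, M.offSupport μ F C₂ π (πs t) (f t) := by
  -- The main case needs coefficients `3`, `32`, `32` on the three error terms and `7` on the regret
  -- term; `40` covers all of them.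
  refine ⟨40, by norm_num, ?_⟩
  intro S A Ω _ _ _ _ _ _ _ Pr _ M μ F hF hFr n T hn hT D hD hind hlaw δ εF εFF lam eta hδ hδ'
    heta hlam π hreal hcomp C₂ hC₂
  classical
  have : Nonempty A := by
    by_contra hne
    rw [not_nonempty_iff] at hne
    simpa using OfflineRL.simplex_sum (π M.s₀)
  have hg := M.one_sub_γ_pos
  have hg1 : 1 - M.γ ≤ 1 := by linarith [M.γ_nonneg]
  have hV0 := M.Vmax_nonneg (Classical.arbitrary A)
  have hPolF : (OfflineRL.spiClass F eta T ∪ {π}).Finite :=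
    (OfflineRL.spiClass_finite F eta T).union (Set.finite_singleton π)
  have hπmem : π ∈ OfflineRL.spiClass F eta T ∪ {π} := Set.mem_union_right _ rfl
  have hεF : 0 ≤ εF := by
    obtain ⟨g, -, hgμ, -⟩ := hreal.exists_mem hF hPolF hπmem
    exact (OfflineRL.normSq_nonneg (OfflineRL.simplex_nonneg μ) _).trans hgμ
  have hεFF : 0 ≤ εFF := by
    obtain ⟨g, hg⟩ := hF
    obtain ⟨g', -, hgμ⟩ := hcomp.exists_mem ⟨g, hg⟩ hπmem hg
    exact (OfflineRL.normSq_nonneg (OfflineRL.simplex_nonneg μ) _).trans hgμ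
  have hcard : (1 : ℝ) ≤ F.card := by exact_mod_cast hF.card_pos
  have hlogF : 0 ≤ Real.log (F.card / δ) :=
    Real.log_nonneg ((one_le_div hδ).2 (hδ'.le.trans hcard))
  have hTpos : (0 : ℝ) < T := Nat.cast_pos.2 hT
  have hnpos : (0 : ℝ) < n := Nat.cast_pos.2 hn
  have hs1 : 1 ≤ √C₂ := Real.one_le_sqrt.2 hC₂
  set Y₁ := √(εFF + εF) / (1 - M.γ) with hY₁
  set Y₂ := M.Vmax / (1 - M.γ) * (T * Real.log (F.card / δ) / n) ^ (1 / 3 : ℝ) with hY₂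
  set Y₃ := (M.Vmax * εF / (1 - M.γ) ^ 2) ^ (1 / 3 : ℝ) with hY₃
  set r := M.Vmax / (1 - M.γ) * √(Real.log (Fintype.card A) / T) with hr
  have hY₁0 : 0 ≤ Y₁ := div_nonneg (Real.sqrt_nonneg _) hg.le
  have hY₂0 : 0 ≤ Y₂ := mul_nonneg (div_nonneg hV0 hg.le) (Real.rpow_nonneg (by positivity) _)
  have hY₃0 : 0 ≤ Y₃ := Real.rpow_nonneg (by positivity) _
  have hr0 : 0 ≤ r := mul_nonneg (div_nonneg hV0 hg.le) (Real.sqrt_nonneg _)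
  have hF₁ : √εF / (1 - M.γ) ≤ Y₁ :=
    div_le_div_of_nonneg_right (Real.sqrt_le_sqrt (by linarith)) hg.le
  have hFF₁ : √εFF / (1 - M.γ) ≤ Y₁ :=
    div_le_div_of_nonneg_right (Real.sqrt_le_sqrt (by linarith)) hg.le
  have hoff : ∀ (f : ℕ → S × A → ℝ) (πs : ℕ → OfflineRL.Policy S A),
      0 ≤ (1 / (T : ℝ)) * ∑ t ∈ Finset.range T, M.offSupport μ F C₂ π (πs t) (f t) := fun f πs =>
    mul_nonneg (by positivity) (Finset.sum_nonneg fun t _ => M.offSupport_nonneg _ _ _ _ _ _)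
  -- If the bound holds deterministically, the event is the whole space, and the regret and
  -- off-support terms are dropped by nonnegativity.
  have trivial_bound : (∀ πs : ℕ → OfflineRL.Policy S A,
      M.J π - M.mixtureJ T πs ≤ 40 * (√C₂ * (Y₁ + Y₂ + Y₃))) →
      ∃ G : Set Ω, MeasurableSet G ∧ 1 - δ ≤ Pr.real G ∧
        ∀ ω ∈ G, ∀ (f : ℕ → S × A → ℝ) (πs : ℕ → OfflineRL.Policy S A),
          M.IsPSPIRun F lam eta T (fun i => D i ω) f πs →
          M.J π - M.mixtureJ T πs ≤ 40 * (√C₂ * (Y₁ + Y₂ + Y₃)) + 40 * r +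
            (1 / (T : ℝ)) * ∑ t ∈ Finset.range T, M.offSupport μ F C₂ π (πs t) (f t) := by
    intro h
    refine ⟨Set.univ, MeasurableSet.univ, by rw [probReal_univ]; linarith, fun ω _ f πs _ => ?_⟩
    linarith [h πs, hoff f πs]
  have hY0 : 0 ≤ √C₂ * (Y₁ + Y₂ + Y₃) := by positivity
  rcases hV0.eq_or_lt with hV | hV
  · refine trivial_bound fun πs => ?_
    linarith [M.J_sub_mixtureJ_le_Vmax π T πs]
  -- With one action `log |A| = 0`, so the regret term could not absorb the first round; but then
  -- all policies coincide.
  rcases (Nat.succ_le_of_lt (Fintype.card_pos (α := A))).eq_or_lt with hA | hA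
  · have : Unique A := (Fintype.card_eq_one_iff_nonempty_unique.1 hA.symm).some
    refine trivial_bound fun πs => ?_
    have hsub : ∀ t, πs t = π := fun t => by
      funext s
      apply Subtype.ext
      funext a
      have h1 := OfflineRL.simplex_sum (πs t s)
      have h2 := OfflineRL.simplex_sum (π s)
      rw [Fintype.sum_unique] at h1 h2
      rw [Subsingleton.elim a default, h1, h2]
    have : M.mixtureJ T πs = M.J π := by
      rw [OfflineRL.MDP.mixtureJ_eq]
      simp only [hsub, Finset.sum_const, Finset.card_range, nsmul_eq_mul]
      field_simp
    linarith
  -- With one function, `log (|F| / δ)` may be too small to pay for the union bound. None is needed: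
  -- the only candidate is the realizable function for every policy of the class.
  rcases (Nat.succ_le_of_lt hF.card_pos).eq_or_lt with hF1 | hF2
  · obtain ⟨g, hFg⟩ := Finset.card_eq_one.1 hF1.symm
    refine ⟨Set.univ, MeasurableSet.univ, by rw [probReal_univ]; linarith, fun ω _ f πs h => ?_⟩
    have key := h.J_sub_mixtureJ_le (μ := μ) hV hT hA hFr heta π hC₂
      (a := √εF / (1 - M.γ)) (b := εF) (div_nonneg (Real.sqrt_nonneg _) hg.le)
      fun t h0 ht => by
        obtain ⟨g', hg', hgμ, hgd⟩ := hreal.exists_mem hF hPolF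
          (Set.mem_union_left _ (h.policy_mem h0 ht.le))
        have e : g' = f t := by
          have h1 := h.mem t ht
          rw [hFg, Finset.mem_singleton] at hg' h1
          rw [hg', h1]
        subst e
        exact ⟨(M.evalAt_sub_J_le _ _).trans
          (div_le_div_of_nonneg_right (Real.sqrt_le_sqrt hgd) hg.le), hgμ⟩
    rw [Real.sqrt_mul (by linarith), mul_div_assoc] at key
    have h1 : √C₂ * (√εF / (1 - M.γ)) ≤ √C₂ * Y₁ := mul_le_mul_of_nonneg_left hF₁ (by linarith)
    have h2 : 1 * Y₁ ≤ √C₂ * Y₁ := mul_le_mul_of_nonneg_right hs1 hY₁0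
    have h3 : √C₂ * Y₁ ≤ √C₂ * (Y₁ + Y₂ + Y₃) :=
      mul_le_mul_of_nonneg_left (by linarith) (by linarith)
    linarith
  · have hPolSpi := OfflineRL.spiClass_finite F eta T
    have hPolNe := OfflineRL.spiClass_nonempty hF eta hT
    obtain ⟨hlog1, hlog2, hlog3⟩ := OfflineRL.log_card_bounds hδ hδ' hF2
      ((Set.ncard_pos hPolSpi).2 hPolNe) hT (OfflineRL.spiClass_ncard_le hF eta T)
    set εr := OfflineRL.epsR M.Vmax F.card (OfflineRL.spiClass F eta T).ncard n δ εF with hεr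
    have hεr' : εr = 139 * M.Vmax ^ 2 *
        Real.log ((F.card : ℝ) * (OfflineRL.spiClass F eta T).ncard / δ) / n + 39 * εF := rfl
    set L := Real.log ((F.card : ℝ) * (OfflineRL.spiClass F eta T).ncard / δ)
    have hεrpos : 0 < εr := by
      rw [hεr']
      positivity
    obtain ⟨hlpos, hscale, hX⟩ := OfflineRL.penalty_scale hV hg hg1 hεrpos hnpos
      (mul_nonneg hTpos.le hlogF) hlog3 hεF hεr' hlam
    change lam * εr ≤ 8 * (Y₂ + Y₃) at hX
    have hX1 : 8 * (Y₂ + Y₃) ≤ √C₂ * (8 * (Y₂ + Y₃)) :=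
      le_mul_of_one_le_left (by positivity) hs1
    have hY1 : Y₁ ≤ √C₂ * Y₁ := le_mul_of_one_le_left hY₁0 hs1
    -- If `lam εr > V_max`, the claimed bound already exceeds `V_max`.
    rcases lt_or_ge M.Vmax (lam * εr) with hbig | hsmall
    · refine trivial_bound fun πs => ?_
      have h1 := M.J_sub_mixtureJ_le_Vmax π T πs
      have h2 : √C₂ * (Y₁ + Y₂ + Y₃) = √C₂ * Y₁ + √C₂ * (8 * (Y₂ + Y₃)) / 8 := by ring
      rw [h2]
      linarith
    · obtain ⟨G, hGm, hGp, hG⟩ := M.exists_uniform_concentration μ hV hn hD hind hlaw hF hFr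
        hPolSpi hPolNe hδ
      refine ⟨G, hGm, hGp, fun ω hω f πs h => ?_⟩
      set κ := 8 * M.Vmax ^ 2 * Real.log (2 * F.card ^ 2 *
        (OfflineRL.spiClass F eta T).ncard / δ) / n with hκ
      -- `24 = 8 * 3`, the `3` coming from `log_card_bounds`. So `2 κ` and `4 κ` cost at most `48`
      -- and `96` of the `139` in `εr`.
      have hκle : κ ≤ 24 * (M.Vmax ^ 2 * L / n) := by
        rw [hκ, ← mul_div_assoc]
        refine div_le_div_of_nonneg_right ?_ hnpos.le
        have := mul_le_mul_of_nonneg_left hlog1 (sq_nonneg M.Vmax)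
        linarith
      have hL0 : 0 ≤ M.Vmax ^ 2 * L / n := by positivity
      have hεr2 : εr = 139 * (M.Vmax ^ 2 * L / n) + 39 * εF := by
        rw [hεr']
        ring
      have hround := fun t (h0 : 0 < t) (ht : t < T) =>
        h.round_bounds hlpos hF hFr hPolF (κ := κ) (εr := εr) (by linarith) (by linarith) hsmall
          hreal hcomp ht (Set.mem_union_left _ (h.policy_mem h0 ht.le))
          fun f' hf' g hg => hG ω hω f' hf' g hg _ (h.policy_mem h0 ht.le)
      have key := h.J_sub_mixtureJ_le hV hT hA hFr heta π hC₂
        (add_nonneg (div_nonneg (Real.sqrt_nonneg _) hg.le) (mul_pos hlpos hεrpos).le) hround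
      rw [Real.sqrt_mul (by linarith), mul_div_assoc] at key
      have h1 : √(5 * (M.Vmax / lam) + 3 * εFF) / (1 - M.γ) ≤ 3 * (lam * εr) + 2 * Y₁ := by
        refine (div_le_div_of_nonneg_right
          (OfflineRL.sqrt_mul_add_le (div_pos hV hlpos).le hεFF) hg.le).trans ?_
        rw [add_div, mul_div_assoc, mul_div_assoc, hscale]
        linarith
      have h2 : √C₂ * (√(5 * (M.Vmax / lam) + 3 * εFF) / (1 - M.γ)) ≤
          √C₂ * (24 * (Y₂ + Y₃) + 2 * Y₁) :=
        mul_le_mul_of_nonneg_left (by linarith) (by linarith)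
      have h3 : √C₂ * (24 * (Y₂ + Y₃) + 2 * Y₁) + √C₂ * Y₁ + √C₂ * (8 * (Y₂ + Y₃)) =
          √C₂ * (3 * Y₁ + 32 * Y₂ + 32 * Y₃) := by ring
      have h4 : √C₂ * (3 * Y₁ + 32 * Y₂ + 32 * Y₃) ≤ √C₂ * (40 * (Y₁ + Y₂ + Y₃)) :=
        mul_le_mul_of_nonneg_left (by linarith) (by linarith)
      linarith
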